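/- **Setting.** Consider finite Markov decision processes (MDPs) with state set $\mathcal S$ of size $S$, action set $\mathcal A$ of size $A$, transition probabilities $P(\cdot\mid s,a)$ and reward distributions $r(s,a)$ on $[0,1]$ with means $\bar r_{s,a}$. A policy is a map $\pi$ from states to distributions over actions. Its gain is $g_\pi(s)=\lim_{T\to\infty}\frac1T\mathbb E_\pi[\sum_{t=0}^{T-1}r_t\mid s_0=s]$, and $g^\star(s)=\sup_\pi g_\pi(s)$ (constant in $s$ for weakly communicating MDPs). An MDP is *communicating* if for all states $s\ne s'$ some deterministic policy reaches $s'$ from $s$ in finite expected time, and *weakly communicating* if there is a closed set of states with this property while all other states are transient under every policy. The diameter is $D=\max_{s\neq s'}\min_{\pi:\mathcal S\to\mathcal A}\mathbb E_\pi[\min\{t>0:s_t=s'\}\mid s_0=s]$. The optimal bias span is $H=\max_s b^\star(s)-\min_s b^\star(s)$, where $b^\star$ solves $g^\star+b^\star(s)=\max_a\{\bar r_{s,a}+\sum_{s'}P(s'\mid s,a)b^\star(s')\}$ for all $s$ (we say that the MDP has optimal bias span $H$ if a solution exists and all solutions have this span $H$). An *online algorithm* (possibly randomized) that starts in a state $s_1$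 observes at each time the current state, and, based on everything observed so far and on the known mean rewards, either stops and returns a policy $\hat\pi$, or chooses an action $a$ in the current state $s$; it then observes a reward drawn from $r(s,a)$ and, drawn independently, the next state with law $P(\cdot\mid s,a)$. Let $\tau\in\{0,1,\dots\}\cup\{\infty\}$ be the number of samples used before stopping. Started in $s_1$, it is $(\varepsilon,\delta)$-*PAC* if $\mathbb P(\tau<\infty,\ \exists s:\ g^\star(s)-g_{\hat\pi}(s)>\varepsilon)\le\delta$ on every communicating MDP with the given state and action sets. (Every algorithm with this property on all weakly communicating MDPs is therefore covered.) **Theorem.** 1. There is a universal constant $c>0$ such that for all $S\ge4$, $A\ge4$, $\varepsilon\in(0,\frac14)$, $\delta\in(0,\frac1{16})$, every state $s_1$ and every online algorithm that is $(\varepsilon,\delta)$-PAC when started in $s_1$, there exists an MDP with $S$ states, $A$ actions and rewards in $[0,1]$ that is communicating (in particular weakly communicating), has an optimal bias span $H\le S$ and diameter $D\ge\frac{A^{S-1}}{16\,\varepsilon}$, and on which the algorithm started in $s_1$ satisfies $$\mathbb E[\tau]\ \ge\ c\,\frac{A^{S-1}}{\varepsilon}.$$ 2. Consequently, online sample complexity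 cannot be polynomial in $S$, $A$ and $H$: for all $\varepsilon\in(0,\frac14)$ and $\delta\in(0,\frac1{16})$ there is no polynomial $Q$ in three variables such that for all $S\ge4$ and $A\ge4$ there are a state $s_1$ and an online algorithm, $(\varepsilon,\delta)$-PAC when started in $s_1$, that satisfies $\mathbb E[\tau]\le Q(S,A,H)$ on every communicating MDP with $S$ states, $A$ actions and optimal bias span $H$. -/

import Mathlib

open MeasureTheory ProbabilityTheory Filter
open scoped ENNReal

noncomputable section

/-- A (stationary, possibly stochastic) policy: a distribution over actions for each state. -/
abbrev Policy (S A : ℕ) : Type := Fin S → stdSimplex ℝ (Fin A)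

/-- A finite Markov decision process with `S` states, `A` actions, transition kernel `P` and
rewards distributed on `[0,1]`. -/
structure MDP (S A : ℕ) where
  /-- `P s a` is the law of the next state when action `a` is taken in state `s`. -/
  P : Fin S → Fin A → PMF (Fin S)
  /-- `reward s a` is the law of the reward collected when action `a` is taken in state `s`. -/
  reward : Fin S → Fin A → ProbabilityMeasure unitInterval

namespace MDP

variable {S A : ℕ} (M : MDP S A)

/-- Mean reward of a state-action pair. -/
def meanReward (s : Fin S) (a : Fin A) : ℝ :=
  ∫ x, (x : ℝ) ∂(M.reward s a : Measure unitInterval)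

/-! ### Gain and optimal bias span -/

/-- Transition matrix of the Markov chain induced by the policy `π`. -/
def policyMatrix (π : Policy S A) : Matrix (Fin S) (Fin S) ℝ :=
  fun s s' => ∑ a, (π s : Fin A → ℝ) a * (M.P s a s').toReal

/-- Mean one-step reward of the policy `π` in state `s`. -/
def policyReward (π : Policy S A) (s : Fin S) : ℝ :=
  ∑ a, (π s : Fin A → ℝ) a * M.meanReward s a

/-- The gain of `π` from `s`: the limit of `(1/T) E_π[∑_{t<T} r_t | s_0 = s]`, where
`E_π[r_t | s_0 = s]` is the `s`-entry of `P_π ^ t r_π`. (This Cesàro limit exists for every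
finite chain.) -/
def gain (π : Policy S A) (s : Fin S) : ℝ :=
  limUnder atTop fun T : ℕ =>
    (1 / (T : ℝ)) * ∑ t ∈ Finset.range T, ((M.policyMatrix π) ^ t).mulVec (M.policyReward π) s

/-- The optimal gain (it does not depend on `s` when the MDP is weakly communicating). -/
def optGain (s : Fin S) : ℝ := ⨆ π : Policy S A, M.gain π s

/-- `b` is an optimal bias vector: it solves the optimality (Poisson) equation
`g* + b(s) = max_a (r(s,a) + ∑_{s'} P(s'|s,a) b(s'))`. -/
def IsOptimalBias (b : Fin S → ℝ) : Prop :=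
  ∀ s, M.optGain s + b s = ⨆ a, (M.meanReward s a + ∑ s', (M.P s a s').toReal * b s')

/-- `H` is the optimal bias span: an optimal bias vector exists, and the difference between its
largest and its smallest entry is `H`, whichever optimal bias vector is taken. -/
def HasOptimalBiasSpan (H : ℝ) : Prop :=
  (∃ b, M.IsOptimalBias b) ∧ ∀ b, M.IsOptimalBias b → (⨆ s, b s) - (⨅ s, b s) = H

/-! ### Hitting times, communication, diameter -/

/-- One-step kernel of the state process under the deterministic policy `π`: given
`s_0, …, s_n`, the next state has law `P (s_n) (π (s_n))`. -/
def chainKernel (π : Fin S → Fin A) (n : ℕ) : Kernel (Finset.Iic n → Fin S) (Fin S) :=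
  (Kernel.ofFunOfCountable fun x : Fin S => (M.P x (π x)).toMeasure).comap
    (fun h => h ⟨n, Finset.mem_Iic.2 le_rfl⟩) (measurable_pi_apply _)

instance (π : Fin S → Fin A) (n : ℕ) : IsMarkovKernel (M.chainKernel π n) := by
  have : IsMarkovKernel (Kernel.ofFunOfCountable fun x : Fin S => (M.P x (π x)).toMeasure) :=
    ⟨fun x => by
      change IsProbabilityMeasure (M.P x (π x)).toMeasure
      infer_instance⟩
  unfold chainKernel
  infer_instance

/-- Law of the state trajectory `(s_t)_{t ≥ 0}` started from `s_0 = s` under the deterministic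
policy `π`. -/
def chainLaw (π : Fin S → Fin A) (s : Fin S) : Measure (ℕ → Fin S) :=
  Kernel.trajMeasure (X := fun _ => Fin S) (Measure.dirac s) (M.chainKernel π)

/-- Expectation of `min {t > 0 | s_t = s'}` (infinite if there is no such `t`) from `s_0 = s`
under the deterministic policy `π`. -/
def expectedHit (π : Fin S → Fin A) (s s' : Fin S) : ℝ≥0∞ :=
  ∫⁻ ω, (⨅ (t : ℕ) (_ : 0 < t ∧ ω t = s'), (t : ℝ≥0∞)) ∂(M.chainLaw π s)

/-- The MDP is communicating: every state can be reached in finite expected time from every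
other state. -/
def IsCommunicating : Prop :=
  ∀ s s', s ≠ s' → ∃ π : Fin S → Fin A, M.expectedHit π s s' < ⊤

/-- The MDP is weakly communicating: there is a closed set of states, each reachable from each
other one in finite expected time, and every state outside it is transient under every policy. -/
def IsWeaklyCommunicating : Prop :=
  ∃ C : Set (Fin S),
    (∀ s ∈ C, ∀ a, (M.P s a).support ⊆ C) ∧
    (∀ s ∈ C, ∀ s' ∈ C, s ≠ s' → ∃ π : Fin S → Fin A, M.expectedHit π s s' < ⊤) ∧
    (∀ s ∉ C, ∀ π : Fin S → Fin A, M.chainLaw π s {ω | ∃ t, 0 < t ∧ ω t = s} < 1)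

/-- The diameter `D = max_{s ≠ s'} min_π E_π[min {t > 0 | s_t = s'} | s_0 = s]`. -/
def diameter : ℝ≥0∞ :=
  ⨆ (s : Fin S) (s' : Fin S) (_ : s ≠ s'), ⨅ π : Fin S → Fin A, M.expectedHit π s s'

end MDP

/-! ### Online algorithms -/

/-- What an online algorithm receives at time `t`: the reward `r_{t-1}` of the previous step
(a dummy value `0` at time `0`), the current state `s_t`, and a fresh uniform seed in `[0,1]`
for its internal randomization. -/
abbrev Obs (S : ℕ) : Type := unitInterval × Fin S × unitInterval

/-- Everything received up to and including time `n`. (The past actions are functions of it.) -/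
abbrev History (S n : ℕ) : Type := Finset.Iic n → Obs S

/-- The current state in a history. -/
def History.current {S n : ℕ} (h : History S n) : Fin S :=
  (h ⟨n, Finset.mem_Iic.2 le_rfl⟩).2.1

lemma History.measurable_current {S n : ℕ} :
    Measurable (History.current : History S n → Fin S) :=
  (measurable_pi_apply _).snd.fst

/-- A (possibly randomized) online identification algorithm. At time `n`, i.e. after `n` observed
transitions, it either stops and recommends a policy, or plays an action in the current state. -/
structure OnlineAlgorithm (S A : ℕ) where
  /-- Sampling rule: the action `a_n`. -/
  act : (n : ℕ) → History S n → Fin A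
  measurable_act : ∀ n, Measurable (act n)
  /-- Stopping rule: the histories on which the algorithm stops at time `n`. -/
  halt : (n : ℕ) → Set (History S n)
  measurableSet_halt : ∀ n, MeasurableSet (halt n)
  /-- Recommendation rule: the policy returned when stopping at time `n`. -/
  recommend : (n : ℕ) → History S n → Policy S A
  measurable_recommend : ∀ n, Measurable (recommend n)

namespace OnlineAlgorithm

variable {S A : ℕ} (alg : OnlineAlgorithm S A)

/-- The stopping time `τ`, i.e. the number of samples used (infinite if the algorithm never
stops). -/
def tau (ω : ℕ → Obs S) : ℝ≥0∞ :=
  ⨅ (n : ℕ) (_ : Preorder.frestrictLe n ω ∈ alg.halt n), (n : ℝ≥0∞)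

/-- The sampling kernel: given the history up to time `n`, with current state `s_n` and action
`a_n`, draw independently `r_n ~ reward s_n a_n`, `s_{n+1} ~ P s_n a_n` and a uniform seed. -/
def stepKernel (M : MDP S A) (n : ℕ) : Kernel (History S n) (Obs S) :=
  (Kernel.ofFunOfCountable fun x : Fin S × Fin A =>
      (M.reward x.1 x.2 : Measure unitInterval).prod
        ((M.P x.1 x.2).toMeasure.prod (volume : Measure unitInterval))).comap
    (fun h => (h.current, alg.act n h))
    (History.measurable_current.prodMk (alg.measurable_act n))

instance (M : MDP S A) (n : ℕ) : IsMarkovKernel (alg.stepKernel M n) := by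
  have : IsMarkovKernel (Kernel.ofFunOfCountable fun x : Fin S × Fin A =>
      (M.reward x.1 x.2 : Measure unitInterval).prod
        ((M.P x.1 x.2).toMeasure.prod (volume : Measure unitInterval))) :=
    ⟨fun x => by
      change IsProbabilityMeasure ((M.reward x.1 x.2 : Measure unitInterval).prod
        ((M.P x.1 x.2).toMeasure.prod (volume : Measure unitInterval)))
      infer_instance⟩
  unfold stepKernel
  infer_instance

/-- Law of the observations when the algorithm interacts with `M` from the start state `s₁`. -/
def law (M : MDP S A) (s₁ : Fin S) : Measure (ℕ → Obs S) :=
  Kernel.trajMeasure (X := fun _ => Obs S)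
    ((Measure.dirac (0 : unitInterval)).prod
      ((Measure.dirac s₁).prod (volume : Measure unitInterval)))
    (alg.stepKernel M)

/-- The expected sample complexity `E[τ]` on `M` from the start state `s₁`. -/
def expectedSamples (M : MDP S A) (s₁ : Fin S) : ℝ≥0∞ :=
  ∫⁻ ω, alg.tau ω ∂(alg.law M s₁)

/-- The failure event: `τ < ∞` and the recommended policy is not `ε`-optimal from some state. -/
def failure (M : MDP S A) (ε : ℝ) : Set (ℕ → Obs S) :=
  {ω | ∃ n : ℕ, alg.tau ω = n ∧
    ∃ s, M.optGain s - M.gain (alg.recommend n (Preorder.frestrictLe n ω)) s > ε}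

end OnlineAlgorithm

/-- `(ε,δ)`-PAC online algorithm started in `s₁`. The mean rewards are known to the learner, so an
algorithm is a rule `alg` that may depend on them, whereas the transitions have to be learned.
Correctness is required on communicating MDPs only; hence every algorithm that is `(ε,δ)`-PAC on
all weakly communicating MDPs satisfies this too. -/
def IsPAC {S A : ℕ} (alg : (Fin S → Fin A → ℝ) → OnlineAlgorithm S A) (s₁ : Fin S) (ε δ : ℝ) :
    Prop :=
  ∀ M : MDP S A, M.IsCommunicating →
    (alg M.meanReward).law M s₁ ((alg M.meanReward).failure M ε) ≤ ENNReal.ofReal δ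

end

/-!
# Exponential online sample complexity at bounded optimal bias span

The hard instances are combination locks (`lockMDP`). A goal state, which is also the start state,
pays reward `1` and is left with the small probability `p = 16 * ε / A ^ (S - 1)`, whatever the
action. It is left for the first of the other `S - 1` states, the positions of a lock. They pay
nothing; in each of them one action, the digit of a hidden combination, leads to the next position
(and finally to the goal), and the others lead back to the first one.

A policy that knows the combination is back at the goal after `S - 1` moves. The optimal gain is
therefore close to `1`, and the optimal bias increases by at most `1` from one position to the next
(`lockMDP.optGain_eq`, `lockMDP.hasOptimalBiasSpan`), whereas going from the goal to the lock takes
the time `1 / p` (`lockMDP.le_diameter`). The gain of an arbitrary policy, which opens the lock with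
probability `W` per attempt, is obtained from an explicit solution of the Poisson equation
(`lockMDP.gain_eq`); in this way no general theorem about Cesàro limits of Markov chains is needed.
If `W ≤ 2 / A ^ (S - 1)`, then the policy spends so long in the lock that it is not `ε`-optimal
(`lockMDP.lt_optGain_sub_gain`). Since the probabilities `W` for the various combinations add up
to `1`, each policy fails for at least half of the combinations
(`card_le_two_mul_card_attemptSuccess`).

As long as the goal has not been left, the observations carry no information on the combination:
their law is the same for all locks (`law_preimage_eq`). By averaging over the combinations, a PAC
algorithm stops before it has left the goal with probability at most `2 * δ < 1 / 8`
(`law_earlyStop_le`). The goal is kept for about `1 / (2 * p)` steps with probability at least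
`1 / 2`, so that the expected number of samples is at least a constant multiple of `1 / p`
(`le_expectedSamples`). For `A = 4` this is exponential in `S`, while a polynomial in `S`, `A` and
`H ≤ S` would be polynomial in `S`.
-/

noncomputable section

/-! ### Integrals along trajectories -/

namespace Trajectory

open ProbabilityTheory.Kernel

/-- The history up to time `n + 1` made of a history up to time `n` and a further observation. -/
def snocHistory {α : Type*} (n : ℕ) (z : (Finset.Iic n → α) × α) : Finset.Iic (n + 1) → α :=
  fun i => if hi : i.1 ≤ n then z.1 ⟨i.1, Finset.mem_Iic.2 hi⟩ else z.2

lemma snocHistory_frestrictLe {α : Type*} (n : ℕ) (ω : ℕ → α) :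
    snocHistory n (Preorder.frestrictLe (π := fun _ => α) n ω, ω (n + 1)) =
      Preorder.frestrictLe (π := fun _ => α) (n + 1) ω := by
  funext i
  unfold snocHistory
  split_ifs with hi
  · rfl
  · have : i.1 = n + 1 := by have := Finset.mem_Iic.1 i.2; omega
    simp [Preorder.frestrictLe_apply, this]

variable {α : Type*} [MeasurableSpace α]

/-- Integrating a function of the first `a + 1` coordinates and of the next one. -/
lemma lintegral_trajMeasure_succ {μ₀ : Measure α} [IsProbabilityMeasure μ₀]
    {κ : (n : ℕ) → Kernel (Finset.Iic n → α) α} [∀ n, IsMarkovKernel (κ n)] (a : ℕ)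
    {f : (Finset.Iic a → α) × α → ℝ≥0∞} (hf : Measurable f) :
    ∫⁻ ω, f (Preorder.frestrictLe (π := fun _ => α) a ω, ω (a + 1))
        ∂(trajMeasure (X := fun _ => α) μ₀ κ) =
      ∫⁻ ω, ∫⁻ y, f (Preorder.frestrictLe (π := fun _ => α) a ω, y)
        ∂(κ a (Preorder.frestrictLe (π := fun _ => α) a ω))
        ∂(trajMeasure (X := fun _ => α) μ₀ κ) := by
  rw [← lintegral_map (f := f)
      (g := fun ω : ℕ → α => (Preorder.frestrictLe (π := fun _ => α) a ω, ω (a + 1))) hf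
      (by fun_prop),
    ← map_frestrictLe_trajMeasure_compProd_eq_map_trajMeasure (X := fun _ => α),
    Measure.lintegral_compProd hf,
    lintegral_map (f := fun h => ∫⁻ y, f (h, y) ∂(κ a h)) hf.lintegral_kernel_prod_right'
      (by fun_prop)]

lemma map_zero_trajMeasure {μ₀ : Measure α} [IsProbabilityMeasure μ₀]
    {κ : (n : ℕ) → Kernel (Finset.Iic n → α) α} [∀ n, IsMarkovKernel (κ n)] :
    (trajMeasure (X := fun _ => α) μ₀ κ).map (Preorder.frestrictLe (π := fun _ => α) 0) =
      μ₀.map (fun x _ => x) := by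
  rw [trajMeasure, Measure.map_comp _ _ (by fun_prop), traj_map_frestrictLe, partialTraj_self,
    Measure.id_comp]
  rfl

lemma lintegral_trajMeasure_zero {μ₀ : Measure α} [IsProbabilityMeasure μ₀]
    {κ : (n : ℕ) → Kernel (Finset.Iic n → α) α} [∀ n, IsMarkovKernel (κ n)]
    {f : α → ℝ≥0∞} (hf : Measurable f) :
    ∫⁻ ω, f (ω 0) ∂(trajMeasure (X := fun _ => α) μ₀ κ) = ∫⁻ x, f x ∂μ₀ := by
  have h0 : Measurable fun h : Finset.Iic 0 → α => f (h ⟨0, by simp⟩) :=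
    hf.comp (measurable_pi_apply _)
  have := lintegral_map (μ := trajMeasure (X := fun _ => α) μ₀ κ) h0
    (g := Preorder.frestrictLe (π := fun _ => α) 0) (by fun_prop)
  rw [map_zero_trajMeasure, lintegral_map h0 (by fun_prop)] at this
  exact this.symm

lemma measurable_snocHistory (n : ℕ) : Measurable (snocHistory (α := α) n) := by
  refine measurable_pi_iff.2 fun i => ?_
  unfold snocHistory
  split_ifs <;> fun_prop

/-- If two families of kernels agree on the histories whose entries all lie in `D`, then the
trajectories integrate equally every function of a history that vanishes outside those. -/
lemma lintegral_trajMeasure_congr {μ₀ : Measure α} [IsProbabilityMeasure μ₀]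
    {κ κ' : (n : ℕ) → Kernel (Finset.Iic n → α) α} [∀ n, IsMarkovKernel (κ n)]
    [∀ n, IsMarkovKernel (κ' n)] {D : Set α}
    (hκ : ∀ n h, (∀ i, h i ∈ D) → κ n h = κ' n h) (n : ℕ)
    {f : (Finset.Iic n → α) → ℝ≥0∞} (hf : Measurable f) (hfD : ∀ h, f h ≠ 0 → ∀ i, h i ∈ D) :
    ∫⁻ ω, f (Preorder.frestrictLe (π := fun _ => α) n ω) ∂(trajMeasure (X := fun _ => α) μ₀ κ) =
      ∫⁻ ω, f (Preorder.frestrictLe (π := fun _ => α) n ω)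
        ∂(trajMeasure (X := fun _ => α) μ₀ κ') := by
  induction n with
  | zero =>
    have h0 : Measurable (Preorder.frestrictLe (π := fun _ : ℕ => α) 0) := by fun_prop
    rw [← lintegral_map hf h0, ← lintegral_map hf h0, map_zero_trajMeasure, map_zero_trajMeasure]
  | succ n ih =>
    have hg : Measurable fun z : (Finset.Iic n → α) × α => f (snocHistory n z) :=
      hf.comp (measurable_snocHistory n)
    simp_rw [← snocHistory_frestrictLe]
    rw [lintegral_trajMeasure_succ n hg, lintegral_trajMeasure_succ n hg]
    have hD : ∀ h : Finset.Iic n → α, ¬ (∀ i, h i ∈ D) → ∀ y, f (snocHistory n (h, y)) = 0 := by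
      intro h hh y
      by_contra hne
      refine hh fun i => ?_
      have := hfD _ hne ⟨i.1, Finset.mem_Iic.2 ((Finset.mem_Iic.1 i.2).trans n.le_succ)⟩
      simpa [snocHistory, Finset.mem_Iic.1 i.2] using this
    have key : ∀ h : Finset.Iic n → α, ∫⁻ y, f (snocHistory n (h, y)) ∂(κ n h) =
        ∫⁻ y, f (snocHistory n (h, y)) ∂(κ' n h) := by
      intro h
      by_cases hh : ∀ i, h i ∈ D
      · rw [hκ n h hh]
      · simp [hD h hh]
    simp_rw [key]
    refine ih (f := fun h => ∫⁻ y, f (snocHistory n (h, y)) ∂(κ' n h))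
      hg.lintegral_kernel_prod_right' fun h hne => ?_
    by_contra hh
    exact hne (by simp [hD h hh])

/-- If, as long as the trajectory has stayed in `D`, it stays there one more step with
probability `q`, then the probability of staying for `n` steps is `q ^ n`. -/
lemma trajMeasure_forall_mem {μ₀ : Measure α} [IsProbabilityMeasure μ₀]
    {κ : (n : ℕ) → Kernel (Finset.Iic n → α) α} [∀ n, IsMarkovKernel (κ n)] {D : Set α}
    (hD : MeasurableSet D) {q : ℝ≥0∞} (hκ : ∀ n h, (∀ i, h i ∈ D) → κ n h D = q) (n : ℕ) :
    trajMeasure (X := fun _ => α) μ₀ κ {ω | ∀ i ≤ n, ω i ∈ D} = μ₀ D * q ^ n := by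
  have hm : ∀ n, MeasurableSet {ω : ℕ → α | ∀ i ≤ n, ω i ∈ D} := fun n => by
    have : {ω : ℕ → α | ∀ i ≤ n, ω i ∈ D} = ⋂ i, ⋂ (_ : i ≤ n), {ω | ω i ∈ D} := by
      ext; simp
    rw [this]
    exact .iInter fun i => .iInter fun _ => measurable_pi_apply i hD
  induction n with
  | zero =>
    have := lintegral_trajMeasure_zero (μ₀ := μ₀) (κ := κ) (f := D.indicator 1)
      (measurable_one.indicator hD)
    rw [lintegral_indicator_one hD] at this
    rw [pow_zero, mul_one, ← this, ← lintegral_indicator_one (hm 0)]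
    refine lintegral_congr fun ω => ?_
    by_cases hω : ω 0 ∈ D <;> simp [hω]
  | succ n ih =>
    let E : Set (Finset.Iic n → α) := {h | ∀ i, h i ∈ D}
    have hE : MeasurableSet E := by
      have : E = ⋂ i, {h | h i ∈ D} := by ext; simp [E]
      rw [this]
      exact .iInter fun i => measurable_pi_apply i hD
    have h1 := lintegral_trajMeasure_succ (μ₀ := μ₀) (κ := κ) n (f := (E ×ˢ D).indicator 1)
      (measurable_one.indicator (hE.prod hD))
    have h2 : ∀ ω : ℕ → α, Preorder.frestrictLe (π := fun _ => α) n ω ∈ E ↔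
        ω ∈ {ω : ℕ → α | ∀ i ≤ n, ω i ∈ D} := fun ω => by
      simp [E, Preorder.frestrictLe_apply]
    rw [pow_succ, ← mul_assoc, ← ih, ← lintegral_indicator_one (hm (n + 1))]
    calc _ = _ := lintegral_congr fun ω => by
          have : ω ∈ {ω : ℕ → α | ∀ i ≤ n + 1, ω i ∈ D} ↔
              (Preorder.frestrictLe (π := fun _ => α) n ω, ω (n + 1)) ∈ E ×ˢ D := by
            rw [Set.mem_prod, h2]
            simp only [Set.mem_ofPred_eq]
            constructor
            · exact fun h => ⟨fun i hi => h i (hi.trans n.le_succ), h _ le_rfl⟩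
            · rintro ⟨h, h'⟩ i hi
              rcases Nat.le_succ_iff.1 hi with hi | rfl
              exacts [h i hi, h']
          by_cases hω : ω ∈ {ω : ℕ → α | ∀ i ≤ n + 1, ω i ∈ D}
          · rw [Set.indicator_of_mem hω, Set.indicator_of_mem (this.1 hω)]; rfl
          · rw [Set.indicator_of_notMem hω, Set.indicator_of_notMem (mt this.2 hω)]
      _ = _ := h1
      _ = ∫⁻ ω, q * {ω : ℕ → α | ∀ i ≤ n, ω i ∈ D}.indicator 1 ω
            ∂(trajMeasure (X := fun _ => α) μ₀ κ) := lintegral_congr fun ω => by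
          by_cases hω : Preorder.frestrictLe (π := fun _ => α) n ω ∈ E
          · rw [Set.indicator_of_mem ((h2 ω).1 hω), Pi.one_apply, mul_one, ← hκ n _ hω,
              ← lintegral_indicator_one hD]
            refine lintegral_congr fun y => ?_
            by_cases hy : y ∈ D <;> simp [hω, hy]
          · rw [Set.indicator_of_notMem (mt (h2 ω).2 hω)]
            simp [hω]
      _ = _ := by
          rw [lintegral_const_mul _ (measurable_one.indicator (hm n)),
            lintegral_indicator_one (hm n), mul_comm]

end Trajectory

/-! ### Expected hitting times -/

/-- A first passage time is the number of instants `n` at which passage has not yet occurred. -/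
lemma iInf_hit_eq_tsum {α : Type*} (y : α) (ω : ℕ → α) :
    (⨅ (t : ℕ) (_ : 0 < t ∧ ω t = y), (t : ℝ≥0∞)) =
      ∑' n : ℕ, {ω : ℕ → α | ∀ t, 0 < t → t ≤ n → ω t ≠ y}.indicator (1 : (ℕ → α) → ℝ≥0∞) ω := by
  classical
  by_cases h : ∃ t, 0 < t ∧ ω t = y
  · have hiff : ∀ n, ω ∈ {ω : ℕ → α | ∀ t, 0 < t → t ≤ n → ω t ≠ y} ↔ n < Nat.find h := fun n => by
      rw [Nat.lt_find_iff]
      exact ⟨fun H t ht hp => H t hp.1 ht hp.2, fun H t h0 ht hp => H t ht ⟨h0, hp⟩⟩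
    have h1 : (⨅ (t : ℕ) (_ : 0 < t ∧ ω t = y), (t : ℝ≥0∞)) = (Nat.find h : ℕ) := by
      refine le_antisymm ?_ (le_iInf₂ fun t ht => by exact_mod_cast Nat.find_min' h ht)
      exact iInf₂_le (f := fun (t : ℕ) (_ : 0 < t ∧ ω t = y) => (t : ℝ≥0∞)) _ (Nat.find_spec h)
    rw [h1, tsum_eq_sum (s := Finset.range (Nat.find h))]
    · rw [Finset.sum_congr rfl (g := fun _ => (1 : ℝ≥0∞))]
      · simp
      · intro n hn
        rw [Set.indicator_of_mem ((hiff n).2 (Finset.mem_range.1 hn))]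
        rfl
    · intro n hn
      exact Set.indicator_of_notMem (fun H => hn (Finset.mem_range.2 ((hiff n).1 H))) _
  · push Not at h
    have h1 : (⨅ (t : ℕ) (_ : 0 < t ∧ ω t = y), (t : ℝ≥0∞)) = ⊤ :=
      iInf₂_eq_top.2 fun t ht => absurd ht.2 (h t ht.1)
    have h2 : ∀ n, {ω : ℕ → α | ∀ t, 0 < t → t ≤ n → ω t ≠ y}.indicator
        (1 : (ℕ → α) → ℝ≥0∞) ω = 1 := fun n => by
      have : ω ∈ {ω : ℕ → α | ∀ t, 0 < t → t ≤ n → ω t ≠ y} := fun t h0 _ => h t h0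
      rw [Set.indicator_of_mem this]
      rfl
    simp_rw [h1, h2]
    exact (ENNReal.tsum_const_eq_top_of_ne_zero one_ne_zero).symm

namespace MDP

variable {S A : ℕ} (M : MDP S A)

lemma lintegral_chainKernel (π : Fin S → Fin A) (n : ℕ) (h : Finset.Iic n → Fin S)
    (f : Fin S → ℝ≥0∞) :
    ∫⁻ y, f y ∂(M.chainKernel π n h) =
      ∑ y, M.P (h ⟨n, Finset.mem_Iic.2 le_rfl⟩) (π (h ⟨n, Finset.mem_Iic.2 le_rfl⟩)) y * f y := by
  change ∫⁻ y, f y ∂(M.P _ _).toMeasure = _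
  rw [lintegral_fintype]
  refine Finset.sum_congr rfl fun y _ => ?_
  rw [PMF.toMeasure_apply_singleton _ _ (MeasurableSet.singleton y), mul_comm]

lemma measurableSet_avoid (s' : Fin S) (n : ℕ) :
    MeasurableSet {ω : ℕ → Fin S | ∀ t, 0 < t → t ≤ n → ω t ≠ s'} := by
  have : {ω : ℕ → Fin S | ∀ t, 0 < t → t ≤ n → ω t ≠ s'} =
      ⋂ t, ⋂ (_ : 0 < t), ⋂ (_ : t ≤ n), (fun ω => ω t) ⁻¹' ({s'} : Set (Fin S))ᶜ := by
    ext; simp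
  rw [this]
  exact .iInter fun t => .iInter fun _ => .iInter fun _ =>
    measurable_pi_apply t (MeasurableSet.of_discrete)

lemma expectedHit_eq_tsum (π : Fin S → Fin A) (s s' : Fin S) :
    M.expectedHit π s s' =
      ∑' n : ℕ, M.chainLaw π s {ω | ∀ t, 0 < t → t ≤ n → ω t ≠ s'} := by
  unfold expectedHit
  simp_rw [iInf_hit_eq_tsum]
  rw [lintegral_tsum fun n => (measurable_one.indicator (measurableSet_avoid s' n)).aemeasurable]
  exact tsum_congr fun n => lintegral_indicator_one (measurableSet_avoid s' n)

lemma ae_chainLaw_zero_eq (π : Fin S → Fin A) (s : Fin S) :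
    ∀ᵐ ω ∂(M.chainLaw π s), ω 0 = s := by
  have h : MeasurableSet ({s} : Set (Fin S))ᶜ := .of_discrete
  have h0 := Trajectory.lintegral_trajMeasure_zero (μ₀ := Measure.dirac s)
    (κ := M.chainKernel π) (f := ({s} : Set (Fin S))ᶜ.indicator 1) (measurable_one.indicator h)
  have h1 : MeasurableSet {ω : ℕ → Fin S | ¬ ω 0 = s} := by
    have : {ω : ℕ → Fin S | ¬ ω 0 = s} = (fun ω => ω 0) ⁻¹' ({s} : Set (Fin S))ᶜ := by ext; simp
    rw [this]
    exact measurable_pi_apply 0 h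
  rw [lintegral_indicator_one h] at h0
  rw [ae_iff, ← lintegral_indicator_one h1]
  refine Eq.trans (lintegral_congr fun ω => ?_) (h0.trans (by simp))
  by_cases hω : ω 0 = s <;> simp [hω]

/-- Comparison with a supersolution of the hitting time equation. -/
lemma expectedHit_le (π : Fin S → Fin A) {s s' : Fin S} (hs : s ≠ s') (V : Fin S → ℝ≥0∞)
    (hV' : V s' = 0) (hV : ∀ x, x ≠ s' → 1 + ∑ y, M.P x (π x) y * V y ≤ V x) :
    M.expectedHit π s s' ≤ V s := by
  let E : (n : ℕ) → Set (Finset.Iic n → Fin S) := fun n => {h | ∀ i, h i ≠ s'}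
  have hE : ∀ n, MeasurableSet (E n) := fun n => by
    have : E n = ⋂ i, (fun h => h i) ⁻¹' ({s'} : Set (Fin S))ᶜ := by ext; simp [E]
    rw [this]
    exact .iInter fun i => measurable_pi_apply i .of_discrete
  let B : ℕ → Set (ℕ → Fin S) := fun n => Preorder.frestrictLe (π := fun _ => Fin S) n ⁻¹' E n
  have hB : ∀ n, MeasurableSet (B n) := fun n => by
    have : Measurable (Preorder.frestrictLe (π := fun _ : ℕ => Fin S) n) := by fun_prop
    exact this (hE n)
  have hBmem : ∀ n ω, ω ∈ B n ↔ ∀ t ≤ n, ω t ≠ s' := fun n ω => by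
    simp [B, E, Preorder.frestrictLe_apply]
  -- `a n` is the expectation of `V (ω n)` on the event that `s'` has not been hit up to time `n`
  let a : ℕ → ℝ≥0∞ := fun n => ∫⁻ ω, (B n).indicator (fun ω => V (ω n)) ω ∂(M.chainLaw π s)
  have hstep : ∀ n, M.chainLaw π s (B n) + a (n + 1) ≤ a n := by
    intro n
    have hm : Measurable fun z : (Finset.Iic n → Fin S) × Fin S =>
        (E n ×ˢ Set.univ).indicator (fun z => V z.2) z :=
      ((measurable_of_countable V).comp measurable_snd).indicator ((hE n).prod .univ)
    have h1 : a (n + 1) = ∫⁻ ω, (B n).indicator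
        (fun ω => ∑ y, M.P (ω n) (π (ω n)) y * V y) ω ∂(M.chainLaw π s) := by
      calc a (n + 1) = ∫⁻ ω, (E n ×ˢ Set.univ).indicator (fun z => V z.2)
            (Preorder.frestrictLe (π := fun _ => Fin S) n ω, ω (n + 1)) ∂(M.chainLaw π s) := by
            refine lintegral_congr fun ω => ?_
            by_cases hω : ω ∈ B n
            · have hω' : (Preorder.frestrictLe (π := fun _ => Fin S) n ω, ω (n + 1)) ∈
                E n ×ˢ Set.univ := ⟨hω, trivial⟩
              rw [Set.indicator_of_mem hω']
              by_cases hz : ω (n + 1) = s'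
              · rw [Set.indicator_of_notMem, hz, hV']
                exact fun H => (hBmem _ _).1 H _ le_rfl hz
              · rw [Set.indicator_of_mem]
                refine (hBmem _ _).2 fun t ht => ?_
                rcases Nat.le_succ_iff.1 ht with ht | rfl
                exacts [(hBmem _ _).1 hω t ht, hz]
            · rw [Set.indicator_of_notMem, Set.indicator_of_notMem]
              · exact fun H => hω H.1
              · exact fun H => hω ((hBmem _ _).2 fun t ht =>
                  (hBmem _ _).1 H t (ht.trans n.le_succ))
        _ = _ := Trajectory.lintegral_trajMeasure_succ n hm
        _ = _ := by
            refine lintegral_congr fun ω => ?_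
            by_cases hω : ω ∈ B n
            · rw [Set.indicator_of_mem hω]
              refine Eq.trans (lintegral_congr fun y => ?_) (lintegral_chainKernel M π n
                (Preorder.frestrictLe (π := fun _ => Fin S) n ω) V)
              rw [Set.indicator_of_mem]
              exact ⟨hω, trivial⟩
            · rw [Set.indicator_of_notMem hω]
              refine (lintegral_congr fun y => ?_).trans lintegral_zero
              exact Set.indicator_of_notMem (fun H => hω H.1) _
    rw [h1, ← lintegral_indicator_one (hB n),
      ← lintegral_add_left (measurable_one.indicator (hB n))]
    refine lintegral_mono fun ω => ?_
    by_cases hω : ω ∈ B n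
    · simp only [Set.indicator_of_mem hω]
      exact hV _ ((hBmem _ _).1 hω n le_rfl)
    · simp [Set.indicator_of_notMem hω]
  have hsum : ∀ n, ∑ i ∈ Finset.range n, M.chainLaw π s (B i) + a n ≤ a 0 := by
    intro n
    induction n with
    | zero => simp
    | succ n ih =>
      rw [Finset.sum_range_succ, add_assoc]
      exact (add_le_add_right (hstep n) _).trans ih
  have ha0 : a 0 ≤ V s := by
    have h0 := Trajectory.lintegral_trajMeasure_zero (μ₀ := Measure.dirac s)
      (κ := M.chainKernel π) (f := V) (measurable_of_countable V)
    rw [lintegral_dirac] at h0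
    refine le_trans (lintegral_mono fun ω => ?_) h0.le
    exact Set.indicator_le_self' (f := fun ω : ℕ → Fin S => V (ω 0)) (fun _ _ => zero_le) ω
  rw [expectedHit_eq_tsum]
  refine ENNReal.tsum_le_of_sum_range_le fun n => ?_
  refine le_trans (Finset.sum_le_sum fun i _ => ?_) ((le_add_right le_rfl).trans
    ((hsum n).trans ha0))
  refine measure_mono_ae ?_
  filter_upwards [M.ae_chainLaw_zero_eq π s] with ω hω h
  refine (hBmem _ _).2 fun t ht => ?_
  rcases Nat.eq_zero_or_pos t with rfl | h0
  · rwa [hω]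
  · exact h t h0 ht

lemma expectedHit_le_ofReal (π : Fin S → Fin A) {s s' : Fin S}
    (hs : s ≠ s') (v : Fin S → ℝ) (hv0 : ∀ x, 0 ≤ v x) (hv' : v s' = 0)
    (hv : ∀ x, x ≠ s' → 1 + ∑ y, (M.P x (π x) y).toReal * v y ≤ v x) :
    M.expectedHit π s s' ≤ ENNReal.ofReal (v s) := by
  refine M.expectedHit_le π hs (fun x => ENNReal.ofReal (v x)) (by simp [hv']) fun x hx => ?_
  have h1 : ∀ y, M.P x (π x) y * ENNReal.ofReal (v y) =
      ENNReal.ofReal ((M.P x (π x) y).toReal * v y) := fun y => by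
    rw [ENNReal.ofReal_mul ENNReal.toReal_nonneg, ENNReal.ofReal_toReal (PMF.apply_ne_top _ _)]
  simp_rw [h1]
  have h2 : ∀ y, 0 ≤ (M.P x (π x) y).toReal * v y := fun y =>
    mul_nonneg ENNReal.toReal_nonneg (hv0 y)
  rw [← ENNReal.ofReal_sum_of_nonneg fun y _ => h2 y, ← ENNReal.ofReal_one,
    ← ENNReal.ofReal_add zero_le_one (Finset.sum_nonneg fun y _ => h2 y)]
  exact ENNReal.ofReal_le_ofReal (hv x hx)

/-! ### The gain through the Poisson equation -/

lemma policyMatrix_nonneg (π : Policy S A) (s s' : Fin S) : 0 ≤ M.policyMatrix π s s' :=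
  Finset.sum_nonneg fun a _ => mul_nonneg ((π s).2.1 a) ENNReal.toReal_nonneg

lemma sum_toReal_P (s : Fin S) (a : Fin A) : ∑ s', (M.P s a s').toReal = 1 := by
  rw [← ENNReal.toReal_sum fun s' _ => PMF.apply_ne_top _ _, ← tsum_fintype (L := .unconditional _),
    PMF.tsum_coe, ENNReal.toReal_one]

lemma sum_policyMatrix_mul (π : Policy S A) (s : Fin S) (h : Fin S → ℝ) :
    ∑ s', M.policyMatrix π s s' * h s' =
      ∑ a, (π s : Fin A → ℝ) a * ∑ s', (M.P s a s').toReal * h s' := by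
  simp only [policyMatrix, Finset.sum_mul, Finset.mul_sum]
  rw [Finset.sum_comm]
  simp only [mul_assoc]

lemma sum_policyMatrix (π : Policy S A) (s : Fin S) : ∑ s', M.policyMatrix π s s' = 1 := by
  have := M.sum_policyMatrix_mul π s 1
  simp only [Pi.one_apply, mul_one, sum_toReal_P] at this
  exact this.trans (π s).2.2

/-- A solution of the Poisson equation with constant `g` determines the gain of a policy. -/
lemma gain_eq_of_poisson (π : Policy S A) (g : ℝ) (h : Fin S → ℝ)
    (hp : ∀ s, g + h s = M.policyReward π s + ∑ s', M.policyMatrix π s s' * h s') (s : Fin S) :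
    M.gain π s = g := by
  set P := M.policyMatrix π with hP
  -- the rewards telescope: `P ^ t r = g + P ^ t h - P ^ (t + 1) h`, and `P ^ t h` stays bounded
  have hone : ∀ t, (P ^ t).mulVec (fun _ => g) = fun _ => g := by
    intro t
    induction t with
    | zero => simp
    | succ t ih =>
      rw [pow_succ, ← Matrix.mulVec_mulVec]
      have : P.mulVec (fun _ => g) = fun _ => g := by
        funext x
        simp only [Matrix.mulVec, dotProduct]
        rw [← Finset.sum_mul, hP, sum_policyMatrix, one_mul]
      rw [this, ih]
  have hr : M.policyReward π = (fun _ => g) + h - P.mulVec h := by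
    funext x
    have := hp x
    simp only [Pi.add_apply, Pi.sub_apply, Matrix.mulVec, dotProduct]
    linarith
  have hterm : ∀ t, (P ^ t).mulVec (M.policyReward π) s =
      g + ((P ^ t).mulVec h s - (P ^ (t + 1)).mulVec h s) := by
    intro t
    rw [hr, Matrix.mulVec_sub, Matrix.mulVec_add, hone, Matrix.mulVec_mulVec, ← pow_succ]
    simp only [Pi.add_apply, Pi.sub_apply]
    ring
  have hsum : ∀ T, ∑ t ∈ Finset.range T, (P ^ t).mulVec (M.policyReward π) s =
      T * g + (h s - (P ^ T).mulVec h s) := by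
    intro T
    simp_rw [hterm]
    rw [Finset.sum_add_distrib, Finset.sum_range_sub']
    simp
  obtain ⟨C, hC⟩ : ∃ C, ∀ x, |h x| ≤ C :=
    ⟨∑ y, |h y|, fun x => Finset.single_le_sum (f := fun y => |h y|)
      (fun _ _ => abs_nonneg _) (Finset.mem_univ x)⟩
  have hbd : ∀ T x, |(P ^ T).mulVec h x| ≤ C := by
    intro T
    induction T with
    | zero => simpa using hC
    | succ T ih =>
      intro x
      rw [pow_succ', ← Matrix.mulVec_mulVec]
      generalize (P ^ T).mulVec h = v at ih
      simp only [Matrix.mulVec, dotProduct]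
      calc |∑ y, P x y * v y| ≤ ∑ y, |P x y * v y| := Finset.abs_sum_le_sum_abs _ _
        _ ≤ ∑ y, P x y * C := Finset.sum_le_sum fun y _ => by
            rw [abs_mul, abs_of_nonneg (M.policyMatrix_nonneg π x y)]
            exact mul_le_mul_of_nonneg_left (ih y) (M.policyMatrix_nonneg π x y)
        _ = C := by rw [← Finset.sum_mul, hP, sum_policyMatrix, one_mul]
  have hlim : Tendsto (fun T : ℕ => (h s - (P ^ T).mulVec h s) / T) atTop (nhds 0) := by
    refine squeeze_zero_norm (a := fun T : ℕ => (C + C) / (T : ℝ)) (fun T => ?_)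
      (tendsto_const_div_atTop_nhds_zero_nat _)
    rw [norm_div, Real.norm_natCast, Real.norm_eq_abs]
    gcongr
    exact (abs_sub _ _).trans (add_le_add (hC s) (hbd T s))
  refine Tendsto.limUnder_eq ?_
  have := hlim.const_add g
  rw [add_zero] at this
  refine this.congr' ?_
  filter_upwards [eventually_gt_atTop 0] with T hT
  have hT' : (T : ℝ) ≠ 0 := by exact_mod_cast hT.ne'
  rw [hsum]
  field_simp

end MDP

/-! ### Attempts at a combination lock -/

section Attempt

variable {n : ℕ}

/-- Probability of opening the lock from position `j` without a wrong move, if the right move at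
position `i` is made with probability `w i`. -/
def attemptSuccess (w : Fin n → ℝ) : Fin (n + 1) → ℝ :=
  Fin.reverseInduction 1 fun j x => w j * x

/-- Expected number of moves from position `j` until the lock is opened or a wrong move is made, if
the right move at position `i` is made with probability `w i`. -/
def attemptLength (w : Fin n → ℝ) : Fin (n + 1) → ℝ :=
  Fin.reverseInduction 0 fun j x => 1 + w j * x

@[simp] lemma attemptSuccess_last (w : Fin n → ℝ) : attemptSuccess w (Fin.last n) = 1 :=
  Fin.reverseInduction_last ..

@[simp] lemma attemptSuccess_castSucc (w : Fin n → ℝ) (j : Fin n) :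
    attemptSuccess w j.castSucc = w j * attemptSuccess w j.succ :=
  Fin.reverseInduction_castSucc ..

@[simp] lemma attemptLength_last (w : Fin n → ℝ) : attemptLength w (Fin.last n) = 0 :=
  Fin.reverseInduction_last ..

@[simp] lemma attemptLength_castSucc (w : Fin n → ℝ) (j : Fin n) :
    attemptLength w j.castSucc = 1 + w j * attemptLength w j.succ :=
  Fin.reverseInduction_castSucc ..

/-- A one-step recursion along the positions telescopes. -/
lemma apply_zero_eq_prod_mul {n : ℕ} (w : Fin n → ℝ) (f : Fin (n + 1) → ℝ)
    (hf : ∀ j : Fin n, f j.castSucc = w j * f j.succ) :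
    f 0 = (∏ j, w j) * f (Fin.last n) := by
  induction n with
  | zero => simp
  | succ n ih =>
    have h1 := ih (fun j => w j.succ) (fun j => f j.succ) fun j => by
      rw [← Fin.castSucc_succ, hf]
    have h2 := hf 0
    rw [Fin.castSucc_zero] at h2
    rw [h2, Fin.prod_univ_succ, mul_assoc, ← Fin.succ_last, ← h1]

lemma attemptSuccess_zero (w : Fin n → ℝ) : attemptSuccess w 0 = ∏ j, w j := by
  simpa using apply_zero_eq_prod_mul w (attemptSuccess w) (attemptSuccess_castSucc w)

variable {w : Fin n → ℝ} (h0 : ∀ j, 0 ≤ w j) (h1 : ∀ j, w j ≤ 1)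
include h0 h1

lemma attemptSuccess_bounds (j : Fin (n + 1)) :
    0 ≤ attemptSuccess w j ∧ attemptSuccess w j ≤ 1 := by
  induction j using Fin.reverseInduction with
  | last => simp
  | cast j ih =>
    rw [attemptSuccess_castSucc]
    exact ⟨mul_nonneg (h0 j) ih.1, mul_le_one₀ (h1 j) ih.1 ih.2⟩

/-- The length of an attempt is at most the number `n - j` of positions left, and at least that
number times the probability that all of them are passed. -/
lemma attemptLength_bounds (j : Fin (n + 1)) :
    ((n : ℝ) - j) * attemptSuccess w j ≤ attemptLength w j ∧ attemptLength w j ≤ n - j ∧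
      0 ≤ attemptLength w j := by
  induction j using Fin.reverseInduction with
  | last => simp
  | cast j ih =>
    have hW := attemptSuccess_bounds h0 h1 j.castSucc
    obtain ⟨ih1, ih2, ih3⟩ := ih
    have := mul_le_mul_of_nonneg_left ih1 (h0 j)
    have := mul_le_mul (h1 j) ih2 ih3 zero_le_one
    have := mul_nonneg (h0 j) ih3
    simp only [attemptSuccess_castSucc, attemptLength_castSucc, Fin.val_castSucc, Fin.val_succ,
      Nat.cast_add, Nat.cast_one] at *
    refine ⟨?_, ?_, ?_⟩ <;> nlinarith

lemma one_le_attemptLength_zero (hn : 0 < n) : 1 ≤ attemptLength w 0 := by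
  obtain ⟨m, rfl⟩ : ∃ m, n = m + 1 := ⟨n - 1, by omega⟩
  rw [← Fin.castSucc_zero, attemptLength_castSucc]
  have := mul_nonneg (h0 0) (attemptLength_bounds h0 h1 (Fin.succ 0)).2.2
  linarith

end Attempt

/-! ### The combination lock MDP -/

/-- The law that puts mass `p` on `y` and mass `1 - p` on `x`. -/
def leakLaw {S : ℕ} (x y : Fin S) (p : ℝ) (hp : p ∈ Set.Icc (0 : ℝ) 1) : PMF (Fin S) :=
  PMF.ofFintype (fun z => (if z = y then ENNReal.ofReal p else 0) +
    if z = x then ENNReal.ofReal (1 - p) else 0) (by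
    rw [Finset.sum_add_distrib, Finset.sum_ite_eq', Finset.sum_ite_eq']
    simp only [Finset.mem_univ, if_true]
    rw [← ENNReal.ofReal_add hp.1 (by linarith [hp.2])]
    simp)

/-- A combination lock with combination `c` in front of a goal state. The permutation `e` names the
states: `e (Fin.last n)` is the goal, and `e j` for `j < n` is the state in which `j` digits of the
combination have been entered. In the lock, the right digit leads one position further and any other
one back to the initial position `e 0`; the reward is `0`. At the goal, every action has reward `1`
and leads back to the initial position of the lock with probability `p`. -/
def lockMDP {n A : ℕ} (e : Equiv.Perm (Fin (n + 1))) (p : ℝ) (hp : p ∈ Set.Icc (0 : ℝ) 1)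
    (c : Fin n → Fin A) : MDP (n + 1) A where
  P s a := Fin.lastCases (motive := fun _ => PMF (Fin (n + 1)))
    (leakLaw (e (Fin.last n)) (e 0) p hp)
    (fun j => PMF.pure (if a = c j then e j.succ else e 0)) (e.symm s)
  reward s _ := ⟨Measure.dirac (if s = e (Fin.last n) then 1 else 0), inferInstance⟩

namespace lockMDP

variable {n A : ℕ} (e : Equiv.Perm (Fin (n + 1))) (p : ℝ) (hp : p ∈ Set.Icc (0 : ℝ) 1)
  (c : Fin n → Fin A)

lemma meanReward_eq :
    (lockMDP e p hp c).meanReward = fun s _ => if s = e (Fin.last n) then 1 else 0 := by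
  funext s a
  change ∫ x, (x : ℝ) ∂(Measure.dirac (if s = e (Fin.last n) then (1 : unitInterval) else 0)) = _
  rw [integral_dirac]
  split_ifs <;> simp

lemma P_last (a : Fin A) :
    (lockMDP e p hp c).P (e (Fin.last n)) a = leakLaw (e (Fin.last n)) (e 0) p hp := by
  simp [lockMDP]

lemma P_castSucc (j : Fin n) (a : Fin A) :
    (lockMDP e p hp c).P (e j.castSucc) a = PMF.pure (if a = c j then e j.succ else e 0) := by
  simp [lockMDP]

lemma sum_P_last (a : Fin A) (b : Fin (n + 1) → ℝ) :
    ∑ y, ((lockMDP e p hp c).P (e (Fin.last n)) a y).toReal * b y =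
      p * b (e 0) + (1 - p) * b (e (Fin.last n)) := by
  have h : ∀ y, (leakLaw (e (Fin.last n)) (e 0) p hp y).toReal =
      (if y = e 0 then p else 0) + if y = e (Fin.last n) then 1 - p else 0 := by
    intro y
    have hp' : 0 ≤ 1 - p := by linarith [hp.2]
    rw [leakLaw, PMF.ofFintype_apply, ENNReal.toReal_add (by split_ifs <;> simp)
      (by split_ifs <;> simp)]
    split_ifs <;> simp [ENNReal.toReal_ofReal, hp.1, hp']
  simp_rw [P_last, h, add_mul, Finset.sum_add_distrib, ite_mul, zero_mul]
  simp

lemma sum_P_castSucc (j : Fin n) (a : Fin A) (b : Fin (n + 1) → ℝ) :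
    ∑ y, ((lockMDP e p hp c).P (e j.castSucc) a y).toReal * b y =
      if a = c j then b (e j.succ) else b (e 0) := by
  have h : ∀ x y : Fin (n + 1), (PMF.pure x y).toReal = if y = x then 1 else 0 := fun x y => by
    rw [PMF.pure_apply]
    split_ifs <;> simp
  simp_rw [P_castSucc, h, ite_mul, one_mul, zero_mul]
  simp only [Finset.sum_ite_eq', Finset.mem_univ, if_true]
  split_ifs <;> rfl

lemma castSucc_ne_last (j : Fin n) : e j.castSucc ≠ e (Fin.last n) := by
  simp

lemma forall_iff {q : Fin (n + 1) → Prop} :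
    (∀ s, q s) ↔ q (e (Fin.last n)) ∧ ∀ j : Fin n, q (e j.castSucc) := by
  rw [← e.forall_congr_right (q := q), Fin.forall_fin_succ']
  exact and_comm

/-! ### Gains in the lock MDP -/

/-- The gain of a policy that opens the lock in one attempt with probability `W`, when attempts
take `U` moves on average, is `W / (W + p * U)`. -/
lemma gain_eq (hp0 : 0 < p) (hn : 0 < n) (π : Policy (n + 1) A) (s : Fin (n + 1)) :
    (lockMDP e p hp c).gain π s =
      attemptSuccess (fun j => (π (e j.castSucc) : Fin A → ℝ) (c j)) 0 /
        (attemptSuccess (fun j => (π (e j.castSucc) : Fin A → ℝ) (c j)) 0 +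
          p * attemptLength (fun j => (π (e j.castSucc) : Fin A → ℝ) (c j)) 0) := by
  set w : Fin n → ℝ := fun j => (π (e j.castSucc) : Fin A → ℝ) (c j) with hw
  have h0 : ∀ j, 0 ≤ w j := fun j => (π _).2.1 _
  have h1 : ∀ j, w j ≤ 1 := fun j => stdSimplex.le_one (π _) _
  have hW := attemptSuccess_bounds h0 h1 0
  have hU := one_le_attemptLength_zero h0 h1 hn
  set W := attemptSuccess w 0
  set U := attemptLength w 0
  have hpos : 0 < W + p * U := by nlinarith
  -- the bias at position `j` is a combination of the success probability and of the length of
  -- an attempt started there; the coefficient `β` makes it vanish at the initial position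
  set g := W / (W + p * U) with hg
  set β := U / (W + p * U) with hβ
  have hβg : β * W - g * U = 0 := by rw [hβ, hg]; ring
  have hgβ : g + p * β = 1 := by rw [hβ, hg]; field_simp
  refine MDP.gain_eq_of_poisson _ π g
    (fun s => β * attemptSuccess w (e.symm s) - g * attemptLength w (e.symm s)) ?_ s
  have hsum : ∀ s, ∑ a, (π s : Fin A → ℝ) a = 1 := fun s => (π s).2.2
  rw [forall_iff e]
  refine ⟨?_, fun j => ?_⟩
  · rw [MDP.sum_policyMatrix_mul]
    simp only [sum_P_last, MDP.policyReward, meanReward_eq, if_true, ← Finset.sum_mul, hsum,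
      Equiv.symm_apply_apply, attemptSuccess_last, attemptLength_last]
    change _ = 1 * 1 + 1 * (p * (β * W - g * U) + _)
    rw [hβg]
    linarith
  · rw [MDP.sum_policyMatrix_mul]
    have hsplit : ∀ x y : ℝ, ∑ a, (π (e j.castSucc) : Fin A → ℝ) a * (if a = c j then x else y) =
        w j * x + (1 - w j) * y := by
      intro x y
      have : ∀ a, (π (e j.castSucc) : Fin A → ℝ) a * (if a = c j then x else y) =
          (if a = c j then (π (e j.castSucc) : Fin A → ℝ) a * (x - y) else 0) +
            (π (e j.castSucc) : Fin A → ℝ) a * y := fun a => by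
        split_ifs <;> ring
      simp_rw [this]
      rw [Finset.sum_add_distrib, Finset.sum_ite_eq', ← Finset.sum_mul, hsum]
      simp only [Finset.mem_univ, if_true, hw]
      ring
    simp only [sum_P_castSucc, hsplit, MDP.policyReward, meanReward_eq, castSucc_ne_last, if_false,
      mul_zero, Finset.sum_const_zero, Equiv.symm_apply_apply, attemptSuccess_castSucc,
      attemptLength_castSucc]
    change _ = 0 + (_ + (1 - w j) * (β * W - g * U))
    rw [hβg]
    ring

/-- A successful attempt takes at least `n` moves, which bounds all gains by that of the policy
that enters the right combination. -/
lemma gain_le (hp0 : 0 < p) (hn : 0 < n) (π : Policy (n + 1) A) (s : Fin (n + 1)) :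
    (lockMDP e p hp c).gain π s ≤ 1 / (1 + p * n) := by
  rw [gain_eq e p hp c hp0 hn]
  set w : Fin n → ℝ := fun j => (π (e j.castSucc) : Fin A → ℝ) (c j) with hw
  have h0 : ∀ j, 0 ≤ w j := fun j => (π _).2.1 _
  have h1 : ∀ j, w j ≤ 1 := fun j => stdSimplex.le_one (π _) _
  have hW := attemptSuccess_bounds h0 h1 0
  have hU := one_le_attemptLength_zero h0 h1 hn
  have hUW := (attemptLength_bounds h0 h1 0).1
  simp only [Fin.val_zero, Nat.cast_zero, sub_zero] at hUW
  have := mul_le_mul_of_nonneg_left hUW hp0.le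
  rw [div_le_div_iff₀ (by nlinarith) (by positivity)]
  nlinarith

/-- The deterministic choice of actions that enters the right combination. -/
def openLock (hn : 0 < n) (s : Fin (n + 1)) : Fin A :=
  Fin.lastCases (motive := fun _ => Fin A) (c ⟨0, hn⟩) c (e.symm s)

lemma openLock_castSucc (hn : 0 < n) (j : Fin n) : openLock e c hn (e j.castSucc) = c j := by
  simp [openLock]

lemma optGain_eq (hp0 : 0 < p) (hn : 0 < n) (s : Fin (n + 1)) :
    (lockMDP e p hp c).optGain s = 1 / (1 + p * n) := by
  classical
  let π : Policy (n + 1) A := fun s =>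
    ⟨Pi.single (openLock e c hn s) 1, single_mem_stdSimplex ℝ _⟩
  have hbdd : BddAbove (Set.range fun π => (lockMDP e p hp c).gain π s) :=
    ⟨_, Set.forall_mem_range.2 fun π => gain_le e p hp c hp0 hn π s⟩
  have : Nonempty (Policy (n + 1) A) := ⟨π⟩
  refine le_antisymm (ciSup_le fun π => gain_le e p hp c hp0 hn π s) ?_
  refine le_trans ?_ (le_ciSup hbdd π)
  have hw : (fun j => (π (e j.castSucc) : Fin A → ℝ) (c j)) = fun _ => 1 := by
    funext j
    change (Pi.single (openLock e c hn (e j.castSucc)) 1 : Fin A → ℝ) (c j) = 1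
    rw [openLock_castSucc, Pi.single_eq_same]
  rw [gain_eq e p hp c hp0 hn, hw, attemptSuccess_zero, Finset.prod_const_one]
  have h0 : ∀ j : Fin n, (0 : ℝ) ≤ (fun _ : Fin n => (1 : ℝ)) j := fun _ => zero_le_one
  have h1 : ∀ j : Fin n, (fun _ : Fin n => (1 : ℝ)) j ≤ 1 := fun _ => le_rfl
  have hU := one_le_attemptLength_zero h0 h1 hn
  have hU' := (attemptLength_bounds h0 h1 0).2.1
  simp only [Fin.val_zero, Nat.cast_zero, sub_zero] at hU'
  have : 0 < 1 + p * attemptLength (fun _ : Fin n => (1 : ℝ)) 0 := by positivity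
  gcongr

/-! ### Bias, communication and diameter of the lock MDP -/

lemma isOptimalBias (hp0 : 0 < p) (hn : 0 < n) :
    (lockMDP e p hp c).IsOptimalBias fun s => (e.symm s : ℝ) * (1 / (1 + p * n)) := by
  have : Nonempty (Fin A) := ⟨c ⟨0, hn⟩⟩
  unfold MDP.IsOptimalBias
  have hpos : (0 : ℝ) < 1 + p * n := by positivity
  have hg : (0 : ℝ) < 1 / (1 + p * n) := by positivity
  simp_rw [optGain_eq e p hp c hp0 hn]
  rw [forall_iff e]
  refine ⟨?_, fun j => ?_⟩
  · simp only [sum_P_last, meanReward_eq, if_true, Equiv.symm_apply_apply, ciSup_const, Fin.val_zero,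
      Fin.val_last]
    field_simp
    push_cast
    ring
  · simp only [sum_P_castSucc, meanReward_eq, castSucc_ne_last, if_false, Equiv.symm_apply_apply,
      Fin.val_zero, Fin.val_castSucc, Fin.val_succ]
    refine le_antisymm ?_ (ciSup_le fun a => ?_)
    · refine le_trans (le_of_eq ?_) (le_ciSup (Set.finite_range _).bddAbove (c j))
      simp
      ring
    · split_ifs
      · push_cast
        linarith
      · have : (0 : ℝ) ≤ (j : ℕ) * (1 / (1 + p * n)) := by positivity
        push_cast
        linarith

/-- Every optimal bias vector of the lock MDP increases by the optimal gain with each position: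
it cannot increase more, and the equation at the goal fixes the total increase. -/
lemma apply_of_isOptimalBias (hp0 : 0 < p) (hn : 0 < n) {b : Fin (n + 1) → ℝ}
    (hb : (lockMDP e p hp c).IsOptimalBias b) (j : Fin (n + 1)) :
    b (e j) = b (e 0) + j * (1 / (1 + p * n)) := by
  have : Nonempty (Fin A) := ⟨c ⟨0, hn⟩⟩
  unfold MDP.IsOptimalBias at hb
  simp_rw [optGain_eq e p hp c hp0 hn] at hb
  rw [forall_iff e] at hb
  have hpos : (0 : ℝ) < 1 + p * n := by positivity
  obtain ⟨hlast, hlock⟩ := hb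
  set g := 1 / (1 + p * n) with hg
  have hgp : g * (1 + p * n) = 1 := by rw [hg]; field_simp
  simp only [sum_P_last, meanReward_eq, if_true, ciSup_const] at hlast
  have htot : b (e (Fin.last n)) = b (e 0) + n * g := by
    have : p * (b (e (Fin.last n)) - b (e 0) - n * g) = 0 := by linarith
    rcases mul_eq_zero.1 this with h | h <;> linarith
  have hstep : ∀ j : Fin n, b (e j.succ) ≤ b (e j.castSucc) + g := fun j => by
    have h1 := hlock j
    simp only [sum_P_castSucc, meanReward_eq, castSucc_ne_last, if_false] at h1
    have h2 := le_ciSup (f := fun a => 0 + if a = c j then b (e j.succ) else b (e 0))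
      (Set.finite_range _).bddAbove (c j)
    simp only [if_true] at h2
    linarith
  refine le_antisymm ?_ ?_
  · induction j using Fin.induction with
    | zero => simp
    | succ j ih =>
      have := hstep j
      simp only [Fin.val_succ, Fin.val_castSucc] at *
      push_cast
      linarith
  · induction j using Fin.reverseInduction with
    | last => rw [htot]; simp
    | cast j ih =>
      have := hstep j
      simp only [Fin.val_succ, Fin.val_castSucc] at *
      push_cast at ih
      linarith

lemma hasOptimalBiasSpan (hp0 : 0 < p) (hn : 0 < n) :
    (lockMDP e p hp c).HasOptimalBiasSpan (n * (1 / (1 + p * n))) := by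
  refine ⟨⟨_, isOptimalBias e p hp c hp0 hn⟩, fun b hb => ?_⟩
  have h := apply_of_isOptimalBias e p hp c hp0 hn hb
  have hg : (0 : ℝ) < 1 / (1 + p * n) := by positivity
  have hle : ∀ s, b s ≤ b (e (Fin.last n)) := fun s => by
    rw [← e.apply_symm_apply s, h, h (Fin.last n), Fin.val_last]
    gcongr
    exact_mod_cast (e.symm s).is_le
  have hge : ∀ s, b (e 0) ≤ b s := fun s => by
    rw [← e.apply_symm_apply s, h (e.symm s)]
    have : (0 : ℝ) ≤ (e.symm s : ℕ) * (1 / (1 + p * n)) := by positivity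
    linarith
  have h1 : ⨆ s, b s = b (e (Fin.last n)) :=
    le_antisymm (ciSup_le hle) (le_ciSup (Set.finite_range b).bddAbove _)
  have h2 : ⨅ s, b s = b (e 0) :=
    le_antisymm (ciInf_le (Set.finite_range b).bddBelow _) (le_ciInf hge)
  rw [h1, h2, h (Fin.last n), Fin.val_last]
  ring

/-- Entering the right combination leads everywhere: the supersolution counts the positions
still to be passed, a visit of the goal counting for `1 / p` moves. -/
lemma isCommunicating (hp0 : 0 < p) (hn : 0 < n) : (lockMDP e p hp c).IsCommunicating := by
  intro s s' hs
  refine ⟨openLock e c hn, ?_⟩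
  set k := e.symm s' with hk
  let v : Fin (n + 1) → ℝ := fun x =>
    if (e.symm x : ℕ) ≤ k then (k : ℝ) - (e.symm x : ℕ) else n - (e.symm x : ℕ) + 1 / p + k
  refine lt_of_le_of_lt (MDP.expectedHit_le_ofReal _ _ hs v (fun x => ?_) ?_ ?_)
    ENNReal.ofReal_lt_top
  · simp only [v]
    split_ifs with h
    · have : ((e.symm x : ℕ) : ℝ) ≤ k := by exact_mod_cast h
      linarith
    · have : ((e.symm x : ℕ) : ℝ) ≤ n := by exact_mod_cast (e.symm x).is_le
      have : 0 < 1 / p := by positivity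
      have : (0 : ℝ) ≤ (k : ℕ) := by positivity
      linarith
  · simp [v, ← hk]
  · rw [forall_iff e]
    refine ⟨fun hx => ?_, fun j hx => ?_⟩
    · have hkn : (k : ℕ) < n := by
        refine lt_of_le_of_ne k.is_le fun h => hx ?_
        rw [← e.apply_symm_apply s', ← hk]
        congr 1
        exact Fin.ext (by simp [h])
      rw [sum_P_last]
      simp only [v, Equiv.symm_apply_apply, Fin.val_zero, Fin.val_last, zero_le, if_true,
        not_le.2 hkn, if_false]
      field_simp
      push_cast
      linarith
    · have hkj : (k : ℕ) ≠ j := fun h => hx (by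
        rw [← e.apply_symm_apply s', ← hk]
        congr 1
        exact Fin.ext (by simp [h]))
      rw [sum_P_castSucc, openLock_castSucc, if_pos rfl]
      simp only [v, Equiv.symm_apply_apply, Fin.val_castSucc, Fin.val_succ]
      rcases lt_or_gt_of_ne hkj with h | h
      · rw [if_neg (by omega), if_neg (by omega)]
        push_cast
        linarith
      · rw [if_pos (by omega), if_pos (by omega)]
        push_cast
        linarith

lemma isWeaklyCommunicating (hp0 : 0 < p) (hn : 0 < n) :
    (lockMDP e p hp c).IsWeaklyCommunicating :=
  ⟨Set.univ, fun _ _ _ => Set.subset_univ _,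
    fun s _ s' _ h => isCommunicating e p hp c hp0 hn s s' h, fun _ h => absurd trivial h⟩

lemma P_last_self (hn : 0 < n) (a : Fin A) :
    (lockMDP e p hp c).P (e (Fin.last n)) a (e (Fin.last n)) = ENNReal.ofReal (1 - p) := by
  have : Fin.last n ≠ 0 := by
    intro h
    have := congrArg Fin.val h
    simp at this
    omega
  rw [P_last, leakLaw, PMF.ofFintype_apply]
  simp [this]

/-- The goal is left with probability `p` whatever is done, so that the first position of the lock
is reached from it in an expected time of at least `1 / p`. -/
lemma le_diameter (hp0 : 0 < p) (hn : 0 < n) :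
    ENNReal.ofReal (1 / p) ≤ (lockMDP e p hp c).diameter := by
  have hne : e (Fin.last n) ≠ e 0 := by
    simp only [ne_eq, EmbeddingLike.apply_eq_iff_eq, Fin.ext_iff, Fin.val_last, Fin.val_zero]
    omega
  refine le_trans ?_ (le_iSup₂_of_le (e (Fin.last n)) (e 0) (le_iSup_of_le hne le_rfl))
  refine le_iInf fun π => ?_
  have hstay : ∀ m, (lockMDP e p hp c).chainLaw π (e (Fin.last n))
      {ω | ∀ t ≤ m, ω t ∈ ({e (Fin.last n)} : Set (Fin (n + 1)))} =
        ENNReal.ofReal (1 - p) ^ m := by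
    intro m
    have := Trajectory.trajMeasure_forall_mem (μ₀ := Measure.dirac (e (Fin.last n)))
      (κ := (lockMDP e p hp c).chainKernel π) (D := {e (Fin.last n)})
      (MeasurableSet.singleton _) (q := ENNReal.ofReal (1 - p)) (fun m h hh => by
        change ((lockMDP e p hp c).P (h _) (π (h _))).toMeasure _ = _
        rw [PMF.toMeasure_apply_singleton _ _ (MeasurableSet.singleton _),
          show h ⟨m, Finset.mem_Iic.2 le_rfl⟩ = e (Fin.last n) from hh _,
          P_last_self e p hp c hn]) m
    rw [Measure.dirac_apply_of_mem (Set.mem_singleton _), one_mul] at this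
    exact this
  rw [MDP.expectedHit_eq_tsum]
  calc ENNReal.ofReal (1 / p) = ∑' m, ENNReal.ofReal (1 - p) ^ m := by
        have h1p : 1 - ENNReal.ofReal (1 - p) = ENNReal.ofReal p := by
          conv_lhs => rw [← ENNReal.ofReal_one, ← ENNReal.ofReal_sub _ (by linarith [hp.2]),
            sub_sub_cancel]
        rw [ENNReal.tsum_geometric, h1p, one_div, ENNReal.ofReal_inv_of_pos hp0]
    _ ≤ _ := by
        refine ENNReal.tsum_le_tsum fun m => ?_
        rw [← hstay m]
        refine measure_mono fun ω hω t _ ht => ?_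
        rw [show ω t = e (Fin.last n) from hω t ht]
        exact hne

end lockMDP

/-! ### Many combinations defeat a policy -/

/-- A policy opens the locks with all possible combinations with total probability `1` in one
attempt each, so that it has at most twice the average probability on at least half of them. -/
lemma card_le_two_mul_card_attemptSuccess {n A : ℕ} (q : Fin n → stdSimplex ℝ (Fin A)) :
    A ^ n ≤ 2 * (Finset.univ.filter fun c : Fin n → Fin A =>
      (∏ j, (q j : Fin A → ℝ) (c j)) * (A : ℝ) ^ n ≤ 2).card := by
  have hsum : ∑ c : Fin n → Fin A, ∏ j, (q j : Fin A → ℝ) (c j) = 1 := by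
    have h := Finset.prod_univ_sum (fun _ : Fin n => (Finset.univ : Finset (Fin A)))
      (fun j a => (q j : Fin A → ℝ) a)
    rw [Fintype.piFinset_univ] at h
    rw [← h]
    exact Finset.prod_eq_one fun j _ => (q j).2.2
  have hcard : (Finset.univ.filter fun c : Fin n → Fin A =>
        (∏ j, (q j : Fin A → ℝ) (c j)) * (A : ℝ) ^ n ≤ 2).card +
      (Finset.univ.filter fun c : Fin n → Fin A =>
        ¬ (∏ j, (q j : Fin A → ℝ) (c j)) * (A : ℝ) ^ n ≤ 2).card = A ^ n := by
    rw [Finset.card_filter_add_card_filter_not]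
    simp
  have hbad : 2 * (Finset.univ.filter fun c : Fin n → Fin A =>
      ¬ (∏ j, (q j : Fin A → ℝ) (c j)) * (A : ℝ) ^ n ≤ 2).card ≤ A ^ n := by
    have h1 : ((Finset.univ.filter fun c : Fin n → Fin A =>
        ¬ (∏ j, (q j : Fin A → ℝ) (c j)) * (A : ℝ) ^ n ≤ 2).card : ℝ) * 2 ≤ (A : ℝ) ^ n := by
      calc _ = ∑ c ∈ Finset.univ.filter (fun c : Fin n → Fin A =>
              ¬ (∏ j, (q j : Fin A → ℝ) (c j)) * (A : ℝ) ^ n ≤ 2), (2 : ℝ) := by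
            rw [Finset.sum_const, nsmul_eq_mul]
        _ ≤ ∑ c ∈ Finset.univ.filter (fun c : Fin n → Fin A =>
              ¬ (∏ j, (q j : Fin A → ℝ) (c j)) * (A : ℝ) ^ n ≤ 2),
              (∏ j, (q j : Fin A → ℝ) (c j)) * (A : ℝ) ^ n :=
            Finset.sum_le_sum fun c hc => (not_le.1 (Finset.mem_filter.1 hc).2).le
        _ ≤ ∑ c : Fin n → Fin A, (∏ j, (q j : Fin A → ℝ) (c j)) * (A : ℝ) ^ n :=
            Finset.sum_le_sum_of_subset_of_nonneg (Finset.filter_subset _ _) fun c _ _ =>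
              mul_nonneg (Finset.prod_nonneg fun j _ => (q j).2.1 _) (by positivity)
        _ = (A : ℝ) ^ n := by rw [← Finset.sum_mul, hsum, one_mul]
    have h2 : (((Finset.univ.filter fun c : Fin n → Fin A =>
        ¬ (∏ j, (q j : Fin A → ℝ) (c j)) * (A : ℝ) ^ n ≤ 2).card * 2 : ℕ) : ℝ) ≤ (A ^ n : ℕ) := by
      push_cast
      exact h1
    have := Nat.cast_le.1 h2
    omega
  omega

/-- Under the optimal policy the `n` moves in the lock cost little compared with `A ^ n`; this keeps
the optimal gain above `1 / (1 + 3 / 4 * ε)`. -/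
lemma sixtyFour_mul_le_three_mul_pow {n A : ℕ} (hn : 3 ≤ n) (hA : 4 ≤ A) : 64 * n ≤ 3 * A ^ n := by
  have h : 64 * n ≤ 3 * 4 ^ n := by
    induction n, hn using Nat.le_induction with
    | base => norm_num
    | succ n hn ih => rw [pow_succ]; omega
  exact h.trans (Nat.mul_le_mul_left _ (Nat.pow_le_pow_left hA n))

lemma leak_mem {n A : ℕ} {ε : ℝ} (hn : 3 ≤ n) (hA : 4 ≤ A) (hε : 0 < ε) (hε' : ε < 1 / 4) :
    16 * ε / (A : ℝ) ^ n ∈ Set.Icc (0 : ℝ) 1 := by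
  have hA' : (0 : ℝ) < (A : ℝ) ^ n := by positivity
  have h : (64 * n : ℝ) ≤ 3 * (A : ℝ) ^ n := by exact_mod_cast sixtyFour_mul_le_three_mul_pow hn hA
  have hn' : (3 : ℝ) ≤ n := by exact_mod_cast hn
  exact ⟨by positivity, (div_le_one hA').2 (by linarith)⟩

/-- A policy with at most twice the average probability of opening the lock is not `ε`-optimal. -/
lemma lockMDP.lt_optGain_sub_gain {n A : ℕ} {ε : ℝ} (hn : 3 ≤ n) (hA : 4 ≤ A) (hε : 0 < ε)
    (hε' : ε < 1 / 4) (e : Equiv.Perm (Fin (n + 1))) (c : Fin n → Fin A) (π : Policy (n + 1) A)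
    (hπ : (∏ j : Fin n, (π (e j.castSucc) : Fin A → ℝ) (c j)) * (A : ℝ) ^ n ≤ 2)
    (s : Fin (n + 1)) :
    ε < (lockMDP e _ (leak_mem hn hA hε hε') c).optGain s -
      (lockMDP e _ (leak_mem hn hA hε hε') c).gain π s := by
  have hN : (0 : ℝ) < (A : ℝ) ^ n := by positivity
  have hp0 : 0 < 16 * ε / (A : ℝ) ^ n := by positivity
  have hn0 : 0 < n := by omega
  rw [optGain_eq e _ _ c hp0 hn0, gain_eq e _ _ c hp0 hn0]
  set w : Fin n → ℝ := fun j => (π (e j.castSucc) : Fin A → ℝ) (c j) with hw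
  have h0 : ∀ j, 0 ≤ w j := fun j => (π _).2.1 _
  have h1 : ∀ j, w j ≤ 1 := fun j => stdSimplex.le_one (π _) _
  have hW := (attemptSuccess_bounds h0 h1 0).1
  have hU := one_le_attemptLength_zero h0 h1 hn0
  change (∏ j, w j) * _ ≤ 2 at hπ
  rw [← attemptSuccess_zero] at hπ
  set W := attemptSuccess w 0
  set U := attemptLength w 0
  set p := 16 * ε / (A : ℝ) ^ n with hp
  have hpN : p * (A : ℝ) ^ n = 16 * ε := by rw [hp]; field_simp
  have hopt : 1 / (1 + 3 / 4 * ε) ≤ 1 / (1 + p * n) := by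
    have h : (64 * n : ℝ) ≤ 3 * (A : ℝ) ^ n := by exact_mod_cast sixtyFour_mul_le_three_mul_pow hn hA
    have := mul_le_mul_of_nonneg_left h hp0.le
    apply one_div_le_one_div_of_le (by positivity)
    linarith
  have hgain : W / (W + p * U) ≤ 1 / (1 + 8 * ε) := by
    have hWp : 8 * ε * W ≤ p := by
      refine le_of_mul_le_mul_right ?_ hN
      nlinarith
    have : p ≤ p * U := le_mul_of_one_le_right hp0.le hU
    rw [div_le_div_iff₀ (by linarith) (by positivity)]
    linarith
  have hdiff : ε < 1 / (1 + 3 / 4 * ε) - 1 / (1 + 8 * ε) := by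
    rw [div_sub_div _ _ (by positivity) (by positivity), lt_div_iff₀ (by positivity)]
    -- the difference is `29 / 4 * ε` divided by the product of the denominators
    have : (1 + 3 / 4 * ε) * (1 + 8 * ε) < 29 / 4 := by nlinarith
    have := mul_lt_mul_of_pos_left this hε
    linarith
  linarith

/-! ### First halting times -/

namespace OnlineAlgorithm

variable {S A : ℕ} (alg : OnlineAlgorithm S A)

/-- The histories at the end of which the algorithm stops, and not before. -/
def firstHalt (k : ℕ) : Set (History S k) :=
  alg.halt k ∩ ⋂ (m : ℕ) (hm : m < k),
    (Preorder.frestrictLe₂ (π := fun _ => Obs S) hm.le ⁻¹' alg.halt m)ᶜ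

lemma measurableSet_firstHalt (k : ℕ) : MeasurableSet (alg.firstHalt k) := by
  refine (alg.measurableSet_halt k).inter (.iInter fun m => .iInter fun hm => .compl ?_)
  have : Measurable (Preorder.frestrictLe₂ (π := fun _ : ℕ => Obs S) hm.le) :=
    Preorder.measurable_frestrictLe₂ hm.le
  exact this (alg.measurableSet_halt m)

lemma mem_firstHalt_iff (k : ℕ) (ω : ℕ → Obs S) :
    Preorder.frestrictLe (π := fun _ => Obs S) k ω ∈ alg.firstHalt k ↔
      Preorder.frestrictLe (π := fun _ => Obs S) k ω ∈ alg.halt k ∧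
        ∀ m < k, Preorder.frestrictLe (π := fun _ => Obs S) m ω ∉ alg.halt m := by
  simp only [firstHalt, Set.mem_inter_iff, Set.mem_iInter, Set.mem_compl_iff, Set.mem_preimage]
  rfl

lemma tau_eq_of_mem_firstHalt {k : ℕ} {ω : ℕ → Obs S}
    (h : Preorder.frestrictLe (π := fun _ => Obs S) k ω ∈ alg.firstHalt k) : alg.tau ω = k := by
  rw [mem_firstHalt_iff] at h
  refine le_antisymm ?_ (le_iInf₂ fun m hm => ?_)
  · exact iInf₂_le (f := fun (n : ℕ)
      (_ : Preorder.frestrictLe (π := fun _ => Obs S) n ω ∈ alg.halt n) => (n : ℝ≥0∞)) k h.1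
  · exact_mod_cast not_lt.1 fun hmk => h.2 m hmk hm

lemma le_tau {m : ℕ} {ω : ℕ → Obs S}
    (h : ∀ k ≤ m, Preorder.frestrictLe (π := fun _ => Obs S) k ω ∉ alg.firstHalt k) :
    (m + 1 : ℕ) ≤ alg.tau ω := by
  classical
  refine le_iInf₂ fun j hj => ?_
  have hex : ∃ j, Preorder.frestrictLe (π := fun _ => Obs S) j ω ∈ alg.halt j := ⟨j, hj⟩
  have hle : Nat.find hex ≤ j := Nat.find_min' hex hj
  have : ¬ Nat.find hex ≤ m := fun hm => h _ hm
    ((alg.mem_firstHalt_iff _ ω).2 ⟨Nat.find_spec hex, fun _ => Nat.find_min hex⟩)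
  exact_mod_cast (by omega : m + 1 ≤ j)

lemma pairwise_disjoint_firstHalt (E : (k : ℕ) → Set (History S k))
    (hE : ∀ k, E k ⊆ alg.firstHalt k) :
    Pairwise (Function.onFun Disjoint fun k =>
      Preorder.frestrictLe (π := fun _ => Obs S) k ⁻¹' E k) := by
  intro k l hkl
  refine Set.disjoint_left.2 fun ω hk hl => hkl ?_
  have h1 := alg.tau_eq_of_mem_firstHalt (hE k hk)
  rw [alg.tau_eq_of_mem_firstHalt (hE l hl)] at h1
  exact_mod_cast h1.symm

end OnlineAlgorithm

/-! ### Running an algorithm on a lock before the goal is left -/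

section Lock

variable {n A : ℕ} (e : Equiv.Perm (Fin (n + 1))) (p : ℝ) (hp : p ∈ Set.Icc (0 : ℝ) 1)
  (alg : OnlineAlgorithm (n + 1) A)

/-- The observations made at the goal. -/
def goalObs : Set (Obs (n + 1)) := {o | o.2.1 = e (Fin.last n)}

lemma measurableSet_goalObs : MeasurableSet (goalObs e) := by
  have : goalObs e = (fun o : Obs (n + 1) => o.2.1) ⁻¹' {e (Fin.last n)} := by
    ext; simp [goalObs]
  rw [this]
  exact measurable_snd.fst (MeasurableSet.singleton _)

/-- The histories that have not left the goal. -/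
def goalHistory (k : ℕ) : Set (History (n + 1) k) := {h | ∀ i, h i ∈ goalObs e}

lemma measurableSet_goalHistory (k : ℕ) : MeasurableSet (goalHistory e k) := by
  have : goalHistory e k = ⋂ i, (fun h : History (n + 1) k => h i) ⁻¹' goalObs e := by
    ext; simp [goalHistory]
  rw [this]
  exact .iInter fun i => measurable_pi_apply i (measurableSet_goalObs e)

lemma current_of_mem_goalHistory {k : ℕ} {h : History (n + 1) k} (hh : h ∈ goalHistory e k) :
    h.current = e (Fin.last n) := hh _

lemma stepKernel_lockMDP {k : ℕ} {h : History (n + 1) k} (hh : h ∈ goalHistory e k)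
    (c : Fin n → Fin A) :
    alg.stepKernel (lockMDP e p hp c) k h =
      (Measure.dirac (1 : unitInterval)).prod
        ((leakLaw (e (Fin.last n)) (e 0) p hp).toMeasure.prod (volume : Measure unitInterval)) := by
  change ((Measure.dirac (if h.current = e (Fin.last n) then (1 : unitInterval) else 0))).prod
    (((lockMDP e p hp c).P h.current (alg.act k h)).toMeasure.prod
      (volume : Measure unitInterval)) = _
  rw [current_of_mem_goalHistory e hh, lockMDP.P_last, if_pos rfl]

/-- The law of the histories that have not left the goal does not depend on the combination. -/
lemma law_preimage_eq (c c' : Fin n → Fin A) (s₁ : Fin (n + 1)) {k : ℕ}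
    {E : Set (History (n + 1) k)} (hE : MeasurableSet E) (hE' : E ⊆ goalHistory e k) :
    alg.law (lockMDP e p hp c) s₁ (Preorder.frestrictLe (π := fun _ => Obs (n + 1)) k ⁻¹' E) =
      alg.law (lockMDP e p hp c') s₁
        (Preorder.frestrictLe (π := fun _ => Obs (n + 1)) k ⁻¹' E) := by
  have hm : Measurable (Preorder.frestrictLe (π := fun _ : ℕ => Obs (n + 1)) k) := by fun_prop
  rw [← lintegral_indicator_one (hm hE), ← lintegral_indicator_one (hm hE)]
  exact Trajectory.lintegral_trajMeasure_congr (D := goalObs e)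
    (fun m h hh => by
      rw [stepKernel_lockMDP e p hp alg hh c, stepKernel_lockMDP e p hp alg hh c'])
    k (f := E.indicator 1) (measurable_one.indicator hE)
    fun h hne => hE' (Set.mem_of_indicator_ne_zero hne)

lemma law_stay_goal (hn : 0 < n) (c : Fin n → Fin A) (m : ℕ) :
    alg.law (lockMDP e p hp c) (e (Fin.last n)) {ω | ∀ t ≤ m, ω t ∈ goalObs e} =
      ENNReal.ofReal (1 - p) ^ m := by
  have hprod : goalObs e = Set.univ ×ˢ (({e (Fin.last n)} : Set (Fin (n + 1))) ×ˢ Set.univ) := by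
    ext; simp [goalObs]
  refine (Trajectory.trajMeasure_forall_mem (measurableSet_goalObs e) (q := ENNReal.ofReal (1 - p))
    (fun k h hh => ?_) m).trans ?_
  · rw [stepKernel_lockMDP e p hp alg hh c, hprod, Measure.prod_prod, Measure.prod_prod,
      PMF.toMeasure_apply_singleton _ _ (MeasurableSet.singleton _), measure_univ, measure_univ,
      one_mul, mul_one, ← lockMDP.P_last e p hp c (c ⟨0, hn⟩), lockMDP.P_last_self e p hp c hn]
  · rw [hprod, Measure.prod_prod, Measure.prod_prod]
    simp

/-- The event that the algorithm stops before it has left the goal. -/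
def earlyStop : Set (ℕ → Obs (n + 1)) :=
  ⋃ k, Preorder.frestrictLe (π := fun _ => Obs (n + 1)) k ⁻¹'
    (alg.firstHalt k ∩ goalHistory e k)

lemma measurableSet_earlyStop : MeasurableSet (earlyStop e alg) := by
  refine .iUnion fun k => ?_
  have hm : Measurable (Preorder.frestrictLe (π := fun _ : ℕ => Obs (n + 1)) k) := by fun_prop
  exact hm ((alg.measurableSet_firstHalt k).inter (measurableSet_goalHistory e k))

/-- The histories at the end of which the algorithm stops without having left the goal, and
recommends a policy that is bad at entering the combination `c`. -/
def badStop (c : Fin n → Fin A) (k : ℕ) : Set (History (n + 1) k) :=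
  (alg.firstHalt k ∩ goalHistory e k) ∩
    {h | (∏ j : Fin n, (alg.recommend k h (e j.castSucc) : Fin A → ℝ) (c j)) * (A : ℝ) ^ n ≤ 2}

lemma measurableSet_badStop (c : Fin n → Fin A) (k : ℕ) : MeasurableSet (badStop e alg c k) := by
  refine ((alg.measurableSet_firstHalt k).inter (measurableSet_goalHistory e k)).inter ?_
  refine measurableSet_le (Measurable.mul_const ?_ _) measurable_const
  refine Finset.measurable_prod _ fun j _ => ?_
  exact (measurable_pi_apply (c j)).comp (measurable_subtype_coe.comp
    ((measurable_pi_apply (e j.castSucc)).comp (alg.measurable_recommend k)))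

/-- An algorithm that is correct for all combinations rarely stops before it has left the goal:
whatever it recommends then is wrong for half of the combinations. -/
lemma law_earlyStop_le {ε δ : ℝ} (hn : 3 ≤ n) (hA : 4 ≤ A) (hε : 0 < ε) (hε' : ε < 1 / 4)
    (s₁ : Fin (n + 1))
    (hpac : ∀ c, alg.law (lockMDP e _ (leak_mem hn hA hε hε') c) s₁
      (alg.failure (lockMDP e _ (leak_mem hn hA hε hε') c) ε) ≤ ENNReal.ofReal δ)
    (c₀ : Fin n → Fin A) :
    alg.law (lockMDP e _ (leak_mem hn hA hε hε') c₀) s₁ (earlyStop e alg) ≤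
      2 * ENNReal.ofReal δ := by
  set μ := alg.law (lockMDP e _ (leak_mem hn hA hε hε') c₀) s₁ with hμ
  let G : (Fin n → Fin A) → Set (ℕ → Obs (n + 1)) := fun c =>
    ⋃ k, Preorder.frestrictLe (π := fun _ => Obs (n + 1)) k ⁻¹' badStop e alg c k
  have hm : ∀ k, Measurable (Preorder.frestrictLe (π := fun _ : ℕ => Obs (n + 1)) k) :=
    fun k => by fun_prop
  have hG : ∀ c, MeasurableSet (G c) := fun c =>
    .iUnion fun k => hm k (measurableSet_badStop e alg c k)
  have hGle : ∀ c, μ (G c) ≤ ENNReal.ofReal δ := by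
    intro c
    have hdisj := alg.pairwise_disjoint_firstHalt (badStop e alg c) fun k h hh => hh.1.1
    have hmeas := fun k => hm k (measurableSet_badStop e alg c k)
    refine le_trans (b := alg.law (lockMDP e _ (leak_mem hn hA hε hε') c) s₁ (G c))
      (le_of_eq ?_) ((measure_mono ?_).trans (hpac c))
    · simp only [G]
      -- the events `badStop` for different stopping times have to be transported one by one
      rw [measure_iUnion hdisj hmeas, measure_iUnion hdisj hmeas]
      exact tsum_congr fun k => law_preimage_eq e _ _ alg c₀ c s₁ (measurableSet_badStop e alg c k)
        fun h hh => hh.1.2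
    · refine Set.iUnion_subset fun k ω hω => ?_
      exact ⟨k, alg.tau_eq_of_mem_firstHalt hω.1.1, s₁,
        lockMDP.lt_optGain_sub_gain hn hA hε hε' e c _ hω.2 s₁⟩
  -- each recommendation made early is bad for at least half of the combinations
  have hcount : ∀ ω, ((A ^ n : ℕ) : ℝ≥0∞) * (earlyStop e alg).indicator 1 ω ≤
      2 * ∑ c, (G c).indicator 1 ω := by
    intro ω
    by_cases hω : ω ∈ earlyStop e alg
    · obtain ⟨k, hk⟩ := Set.mem_iUnion.1 hω
      have hc := card_le_two_mul_card_attemptSuccess fun j : Fin n =>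
        alg.recommend k (Preorder.frestrictLe (π := fun _ => Obs (n + 1)) k ω) (e j.castSucc)
      rw [Set.indicator_of_mem hω, Pi.one_apply, mul_one]
      refine le_trans (Nat.cast_le.2 hc) ?_
      rw [Nat.cast_mul, Nat.cast_two]
      gcongr
      rw [Finset.card_eq_sum_ones, Nat.cast_sum, Nat.cast_one, Finset.sum_filter]
      refine Finset.sum_le_sum fun c _ => ?_
      split_ifs with h
      · rw [Set.indicator_of_mem]
        · rfl
        · exact Set.mem_iUnion.2 ⟨k, hk, h⟩
      · exact zero_le
    · rw [Set.indicator_of_notMem hω, mul_zero]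
      exact zero_le
  have hint := lintegral_mono (μ := μ) hcount
  rw [lintegral_const_mul _ (measurable_one.indicator (measurableSet_earlyStop e alg)),
    lintegral_indicator_one (measurableSet_earlyStop e alg),
    lintegral_const_mul _ (Finset.measurable_fun_sum _ fun c _ => measurable_one.indicator (hG c)),
    lintegral_finsetSum _ fun c _ => measurable_one.indicator (hG c)] at hint
  simp_rw [lintegral_indicator_one (hG _)] at hint
  have hsum : ∑ c, μ (G c) ≤ ((A ^ n : ℕ) : ℝ≥0∞) * ENNReal.ofReal δ := by
    refine (Finset.sum_le_sum fun c _ => hGle c).trans_eq ?_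
    simp
  have hN : ((A ^ n : ℕ) : ℝ≥0∞) ≠ 0 := by
    exact_mod_cast (pow_pos (by omega : 0 < A) n).ne'
  rw [← ENNReal.mul_le_mul_iff_right hN (ENNReal.natCast_ne_top _)]
  calc _ ≤ 2 * ∑ c, μ (G c) := hint
    _ ≤ 2 * (((A ^ n : ℕ) : ℝ≥0∞) * ENNReal.ofReal δ) := by gcongr
    _ = _ := by ring

/-- If early stopping is unlikely, then the expected number of samples is of the order of the time
`1 / p` spent at the goal. -/
lemma le_expectedSamples (hp0 : 0 < p) (hn : 0 < n) (c : Fin n → Fin A)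
    (hearly : alg.law (lockMDP e p hp c) (e (Fin.last n)) (earlyStop e alg) ≤
      ENNReal.ofReal (1 / 8)) :
    ENNReal.ofReal (3 / 16 * (1 / p)) ≤
      alg.expectedSamples (lockMDP e p hp c) (e (Fin.last n)) := by
  set μ := alg.law (lockMDP e p hp c) (e (Fin.last n)) with hμ
  -- up to time about `1 / (2 * p)` the goal is kept with probability at least `1 / 2`
  set m := ⌊1 / (2 * p)⌋₊ with hm
  have hmle : (m : ℝ) ≤ 1 / (2 * p) := Nat.floor_le (by positivity)
  have hmlt : 1 / (2 * p) < m + 1 := Nat.lt_floor_add_one _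
  have hmp : m * p ≤ 1 / 2 := by
    calc m * p ≤ 1 / (2 * p) * p := by gcongr
      _ = 1 / 2 := by field_simp
  let E : Set (ℕ → Obs (n + 1)) := {ω | ∀ t ≤ m, ω t ∈ goalObs e}
  have hE : ENNReal.ofReal (1 / 2) ≤ μ E := by
    rw [hμ, law_stay_goal e p hp alg hn c m, ← ENNReal.ofReal_pow (by linarith [hp.2])]
    refine ENNReal.ofReal_le_ofReal ?_
    have := one_add_mul_le_pow (a := -p) (by linarith [hp.2]) m
    rw [← sub_eq_add_neg] at this
    linarith
  have hdiff : ENNReal.ofReal (3 / 8) ≤ μ (E \ earlyStop e alg) := by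
    calc ENNReal.ofReal (3 / 8) = ENNReal.ofReal (1 / 2) - ENNReal.ofReal (1 / 8) := by
          rw [← ENNReal.ofReal_sub _ (by norm_num)]
          norm_num
      _ ≤ μ E - μ (earlyStop e alg) := tsub_le_tsub hE hearly
      _ ≤ _ := le_measure_sdiff
  have htau : ∀ ω ∈ E \ earlyStop e alg, ((m + 1 : ℕ) : ℝ≥0∞) ≤ alg.tau ω := by
    rintro ω ⟨hωE, hω⟩
    refine alg.le_tau fun k hk hhalt => hω (Set.mem_iUnion.2 ⟨k, hhalt, fun i => ?_⟩)
    exact hωE i.1 ((Finset.mem_Iic.1 i.2).trans hk)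
  have hEm : MeasurableSet (E \ earlyStop e alg) := by
    refine MeasurableSet.diff ?_ (measurableSet_earlyStop e alg)
    have : E = ⋂ t, ⋂ (_ : t ≤ m), (fun ω : ℕ → Obs (n + 1) => ω t) ⁻¹' goalObs e := by
      ext; simp [E]
    rw [this]
    exact .iInter fun t => .iInter fun _ => measurable_pi_apply t (measurableSet_goalObs e)
  calc ENNReal.ofReal (3 / 16 * (1 / p)) ≤ ENNReal.ofReal ((m + 1 : ℕ) * (3 / 8)) := by
        refine ENNReal.ofReal_le_ofReal ?_
        have : 3 / 16 * (1 / p) = 1 / (2 * p) * (3 / 8) := by field_simp; norm_num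
        rw [this]
        push_cast
        gcongr
    _ = ((m + 1 : ℕ) : ℝ≥0∞) * ENNReal.ofReal (3 / 8) := by
        rw [ENNReal.ofReal_mul (by positivity), ENNReal.ofReal_natCast]
    _ ≤ ((m + 1 : ℕ) : ℝ≥0∞) * μ (E \ earlyStop e alg) := by gcongr
    _ = ∫⁻ ω in E \ earlyStop e alg, ((m + 1 : ℕ) : ℝ≥0∞) ∂μ := by
        rw [setLIntegral_const]
    _ ≤ ∫⁻ ω in E \ earlyStop e alg, alg.tau ω ∂μ := setLIntegral_mono' hEm htau
    _ ≤ _ := setLIntegral_le_lintegral _ _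

end Lock

/-! ### Lower bound for the sample complexity -/

/-- A real polynomial is bounded by a multiple of a power of any common bound `y ≥ 1` of the
variables. -/
lemma MvPolynomial.exists_abs_eval_le {σ : Type*} (Q : MvPolynomial σ ℝ) :
    ∃ (K : ℝ) (d : ℕ), 0 ≤ K ∧ ∀ (x : σ → ℝ) (y : ℝ), 1 ≤ y → (∀ i, |x i| ≤ y) →
      |MvPolynomial.eval x Q| ≤ K * y ^ d := by
  induction Q using MvPolynomial.induction_on with
  | C a => exact ⟨|a|, 0, abs_nonneg a, fun x y _ _ => by simp⟩
  | add f g hf hg =>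
    obtain ⟨K, d, hK, hf⟩ := hf
    obtain ⟨L, k, hL, hg⟩ := hg
    refine ⟨K + L, max d k, by positivity, fun x y hy hx => ?_⟩
    rw [map_add, add_mul]
    refine (abs_add_le _ _).trans (add_le_add ((hf x y hy hx).trans ?_) ((hg x y hy hx).trans ?_))
    · gcongr
      exacts [le_max_left _ _]
    · gcongr
      exacts [le_max_right _ _]
  | mul_X f i hf =>
    obtain ⟨K, d, hK, hf⟩ := hf
    refine ⟨K, d + 1, hK, fun x y hy hx => ?_⟩
    rw [map_mul, MvPolynomial.eval_X, abs_mul, pow_succ, ← mul_assoc]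
    exact mul_le_mul (hf x y hy hx) (hx i) (abs_nonneg _) (by positivity)

lemma MDP.HasOptimalBiasSpan.nonneg {S A : ℕ} {M : MDP S A} {H : ℝ} (hS : 0 < S)
    (h : M.HasOptimalBiasSpan H) : 0 ≤ H := by
  obtain ⟨⟨b, hb⟩, h⟩ := h
  rw [← h b hb, sub_nonneg]
  exact (ciInf_le (Set.finite_range b).bddBelow ⟨0, hS⟩).trans
    (le_ciSup (Set.finite_range b).bddAbove ⟨0, hS⟩)

/-- Every PAC algorithm needs of the order of `A ^ (S - 1) / ε` samples on a combination lock whose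
goal is the start state and is left with probability `16 * ε / A ^ (S - 1)`. -/
lemma exists_lockMDP_of_isPAC {S A : ℕ} {ε δ : ℝ} (hS : 4 ≤ S) (hA : 4 ≤ A) (hε : 0 < ε)
    (hε' : ε < 1 / 4) (hδ : δ < 1 / 16) (s₁ : Fin S)
    (alg : (Fin S → Fin A → ℝ) → OnlineAlgorithm S A) (hpac : IsPAC alg s₁ ε δ) :
    ∃ M : MDP S A,
      M.IsWeaklyCommunicating ∧ M.IsCommunicating ∧
      (∃ H : ℝ, M.HasOptimalBiasSpan H ∧ H ≤ S) ∧
      ENNReal.ofReal ((A : ℝ) ^ (S - 1) / (16 * ε)) ≤ M.diameter ∧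
      ENNReal.ofReal (3 / 256 * ((A : ℝ) ^ (S - 1) / ε)) ≤
        (alg M.meanReward).expectedSamples M s₁ := by
  obtain ⟨n, rfl⟩ : ∃ n, S = n + 1 := ⟨S - 1, by omega⟩
  have hn : 3 ≤ n := by omega
  have hn0 : 0 < n := by omega
  -- the states are named so that the prescribed start state is the goal
  let e : Equiv.Perm (Fin (n + 1)) := Equiv.swap s₁ (Fin.last n)
  have he : e (Fin.last n) = s₁ := Equiv.swap_apply_right _ _
  have hp := leak_mem hn hA hε hε'
  have hp0 : 0 < 16 * ε / (A : ℝ) ^ n := by positivity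
  let c₀ : Fin n → Fin A := fun _ => ⟨0, by omega⟩
  have hinv : 1 / (16 * ε / (A : ℝ) ^ n) = (A : ℝ) ^ n / (16 * ε) := by rw [one_div_div]
  refine ⟨lockMDP e _ hp c₀, lockMDP.isWeaklyCommunicating e _ hp c₀ hp0 hn0,
    lockMDP.isCommunicating e _ hp c₀ hp0 hn0,
    ⟨_, lockMDP.hasOptimalBiasSpan e _ hp c₀ hp0 hn0, ?_⟩, ?_, ?_⟩
  · have : 1 / (1 + 16 * ε / (A : ℝ) ^ n * n) ≤ 1 := by
      rw [div_le_one (by positivity)]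
      have : 0 ≤ 16 * ε / (A : ℝ) ^ n * n := by positivity
      linarith
    push_cast
    nlinarith [(Nat.cast_nonneg n : (0 : ℝ) ≤ n)]
  · rw [Nat.add_sub_cancel, ← hinv]
    exact lockMDP.le_diameter e _ hp c₀ hp0 hn0
  · rw [lockMDP.meanReward_eq, Nat.add_sub_cancel]
    set alg₀ := alg fun s _ => if s = e (Fin.last n) then 1 else 0 with halg
    have hpac' : ∀ c, alg₀.law (lockMDP e _ hp c) (e (Fin.last n))
        (alg₀.failure (lockMDP e _ hp c) ε) ≤ ENNReal.ofReal δ := fun c => by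
      have := hpac (lockMDP e _ hp c) (lockMDP.isCommunicating e _ hp c hp0 hn0)
      rwa [lockMDP.meanReward_eq, ← halg, ← he] at this
    have hearly := law_earlyStop_le e alg₀ hn hA hε hε' (e (Fin.last n)) hpac' c₀
    have h8 : 2 * ENNReal.ofReal δ ≤ ENNReal.ofReal (1 / 8) := by
      rw [← ENNReal.ofReal_ofNat 2, ← ENNReal.ofReal_mul (by norm_num)]
      exact ENNReal.ofReal_le_ofReal (by norm_num; linarith)
    have := le_expectedSamples e _ hp alg₀ hp0 hn0 c₀ (hearly.trans h8)
    rw [hinv, he] at this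
    refine le_trans (le_of_eq ?_) this
    congr 1
    field_simp
    norm_num

end

theorem mainTheorem3 :
    (∃ c : ℝ, 0 < c ∧
      ∀ (S A : ℕ) (ε δ : ℝ), 4 ≤ S → 4 ≤ A → 0 < ε → ε < 1 / 4 → 0 < δ → δ < 1 / 16 →
      ∀ (s₁ : Fin S) (alg : (Fin S → Fin A → ℝ) → OnlineAlgorithm S A), IsPAC alg s₁ ε δ →
      ∃ M : MDP S A,
        M.IsWeaklyCommunicating ∧ M.IsCommunicating ∧
        (∃ H : ℝ, M.HasOptimalBiasSpan H ∧ H ≤ S) ∧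
        ENNReal.ofReal ((A : ℝ) ^ (S - 1) / (16 * ε)) ≤ M.diameter ∧
        ENNReal.ofReal (c * ((A : ℝ) ^ (S - 1) / ε)) ≤
          (alg M.meanReward).expectedSamples M s₁) ∧
    (∀ ε δ : ℝ, 0 < ε → ε < 1 / 4 → 0 < δ → δ < 1 / 16 →
      ¬ ∃ Q : MvPolynomial (Fin 3) ℝ, ∀ S A : ℕ, 4 ≤ S → 4 ≤ A →
        ∃ (s₁ : Fin S) (alg : (Fin S → Fin A → ℝ) → OnlineAlgorithm S A),
          IsPAC alg s₁ ε δ ∧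
          ∀ M : MDP S A, M.IsCommunicating → ∀ H : ℝ, M.HasOptimalBiasSpan H →
            (alg M.meanReward).expectedSamples M s₁ ≤
              ENNReal.ofReal (MvPolynomial.eval ![(S : ℝ), (A : ℝ), H] Q)) := by
  have hlower := fun (S A : ℕ) (ε δ : ℝ) (hS : 4 ≤ S) (hA : 4 ≤ A) (hε : 0 < ε) (hε' : ε < 1 / 4)
    (_ : 0 < δ) (hδ : δ < 1 / 16) (s₁ : Fin S)
    (alg : (Fin S → Fin A → ℝ) → OnlineAlgorithm S A) (hpac : IsPAC alg s₁ ε δ) =>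
    exists_lockMDP_of_isPAC hS hA hε hε' hδ s₁ alg hpac
  refine ⟨⟨3 / 256, by norm_num, hlower⟩, ?_⟩
  rintro ε δ hε hε' hδ hδ' ⟨Q, hQ⟩
  obtain ⟨K, d, hK, hbound⟩ := Q.exists_abs_eval_le
  -- four actions suffice: the lower bound is then of the order of `4 ^ S`, the upper one of `S ^ d`
  have hexp : ∀ S : ℕ, 4 ≤ S → 3 / 256 * ((4 : ℝ) ^ (S - 1) / ε) ≤ K * (S : ℝ) ^ d := by
    intro S hS
    obtain ⟨s₁, alg, hpac, hupper⟩ := hQ S 4 hS le_rfl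
    obtain ⟨M, -, hcomm, ⟨H, hH, hHS⟩, -, hsamples⟩ :=
      hlower S 4 ε δ hS le_rfl hε hε' hδ hδ' s₁ alg hpac
    have h1 := hsamples.trans (hupper M hcomm H hH)
    have hpos : 0 < 3 / 256 * (((4 : ℕ) : ℝ) ^ (S - 1) / ε) := by positivity
    rw [ENNReal.ofReal_le_ofReal_iff'] at h1
    have h2 := h1.resolve_right (not_le.2 hpos)
    have hS' : (4 : ℝ) ≤ S := by exact_mod_cast hS
    have hH0 := hH.nonneg (by omega)
    refine le_trans (by simpa using h2) ((le_abs_self _).trans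
      (hbound _ (S : ℝ) (by linarith) fun i => ?_))
    fin_cases i
    · simp
    · simpa using hS'
    · simpa [abs_of_nonneg hH0] using hHS
  have hlim := (tendsto_pow_const_div_const_pow_of_one_lt d (by norm_num : (1 : ℝ) < 4)).const_mul K
  rw [mul_zero] at hlim
  have hev := hlim.eventually_lt_const (show (0 : ℝ) < 3 / 1024 / ε by positivity)
  obtain ⟨S, hS, hlt⟩ := ((eventually_ge_atTop 4).and hev).exists
  have h := hexp S hS
  obtain ⟨m, rfl⟩ : ∃ m, S = m + 1 := ⟨S - 1, by omega⟩
  rw [Nat.add_sub_cancel] at h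
  rw [← mul_div_assoc, div_lt_iff₀ (by positivity), pow_succ (4 : ℝ) m] at hlt
  have : 3 / 1024 / ε * ((4 : ℝ) ^ m * 4) = 3 / 256 * ((4 : ℝ) ^ m / ε) := by field_simp; norm_num
  linarith
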